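/- Let $d\ge 2$ and let $N_1,\dots,N_m$ be real $(d+1)\times(d+1)$ matrices with non-negative entries and determinant $\pm1$. Let $\Delta=\{x\in[0,1]^{d+1}:|x|=1\}$ be the standard $d$-simplex, where $|\cdot|$ is the $\ell^1$ norm, and let $T_j:\Delta\to\Delta$, $T_j(x)=N_jx/|N_jx|$, be the projectivisations. For a finite word $i=(i_1,\dots,i_n)$ over $\{1,\dots,m\}$ (the empty word included) put $N_i=N_{i_1}\cdots N_{i_n}$ and $T_i=T_{i_1}\circ\dots\circ T_{i_n}$ (the identity if $i$ is empty); let $\mathcal I$ be the set of all finite words. Let $$\mathcal G=\bigcap_{n\ge1}\ \bigcup_{|i|=n}T_i(\Delta)$$ be the limit set of $T_1,\dots,T_m$. It satisfies $\mathcal G=\bigcup_jT_j(\mathcal G)$ and is the largest subset of $\Delta$ that does. Interiors are taken in the hyperplane $\{x\in\mathbb R^{d+1}:\sum_kx_k=1\}$, and $\operatorname{vol}$ is $d$-dimensional Lebesgue measure on it. Suppose that - the images $T_1(\Delta),\dots,T_m(\Delta)$ have pairwise disjoint interiors, - $\operatorname{vol}(\mathcal G)=0$, and - every connected component of $\Delta\setminus\bigcup_jT_j(\Delta)$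 is the interior of a (non-degenerate) $d$-simplex. Let $\|\cdot\|$ be any norm on the space of real $(d+1)\times(d+1)$ matrices. Then the following hold. 1. For every $T$ the set $\{i\in\mathcal I:\|N_i\|\le T\}$ is finite. The sets $\{r\ge0:\sum_{i\in\mathcal I}\|N_i\|^{-r}<\infty\}$ and $\{t>0:\sum_{n=1}^\infty\sum_{|i|=n}\|N_i\|^{-t}<\infty\}$ are non-empty and have the same infimum $\rho$, and $$\rho=\lim_{T\to\infty}\frac{\log\#\{i\in\mathcal I:\|N_i\|\le T\}}{\log T}=\lim_{t\to\infty}\frac1t\log\#\{i\in\mathcal I:\|N_i\|<e^t\},$$ where both limits exist. 2. The upper box-counting dimension $$\overline{\dim}_B(\mathcal G)=d-\liminf_{\varepsilon\to0^+}\frac{\log\operatorname{vol}(\mathcal G_\varepsilon)}{\log\varepsilon},\qquad \mathcal G_\varepsilon=\{x\in\Delta:\|x-y\|_2\le\varepsilon\text{ for some }y\in\mathcal G\},$$ satisfies $$\overline{\dim}_B(\mathcal G)\ \ge\ \frac{d-1}{d}\,\rho\qquad\text{and}\qquad \overline{\dim}_B(\mathcal G)\ \ge\ \max\Bigl(d-1,\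 \frac{d\rho}{d+1}\Bigr).$$ -/

import Mathlib

open MeasureTheory Filter Topology Set

namespace SelfProjective

/-- The affine hyperplane of points of `ℝ^(d+1)` (with its Euclidean metric) whose coordinates
sum to `1`. -/
def hyperplane (d : ℕ) : Set (EuclideanSpace ℝ (Fin (d + 1))) :=
  {x | ∑ i, x i = 1}

/-- The standard `d`-simplex: non-negative coordinates which sum to `1`. -/
def simplex (d : ℕ) : Set (EuclideanSpace ℝ (Fin (d + 1))) :=
  {x | (∀ i, 0 ≤ x i) ∧ ∑ i, x i = 1}

/-- The interior of a set, relative to the hyperplane. -/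
def relInterior {d : ℕ} (s : Set (EuclideanSpace ℝ (Fin (d + 1)))) :
    Set (EuclideanSpace ℝ (Fin (d + 1))) :=
  Subtype.val '' interior (Subtype.val ⁻¹' s : Set (hyperplane d))

/-- A matrix that may be projectivised: non-negative entries and determinant `±1`. -/
def IsAdmissible {d : ℕ} (N : Matrix (Fin (d + 1)) (Fin (d + 1)) ℝ) : Prop :=
  (∀ i j, 0 ≤ N i j) ∧ (N.det = 1 ∨ N.det = -1)

/-- The projectivisation `x ↦ N x / |N x|`, where `|·|` is the `ℓ¹` norm. -/
noncomputable def proj {d : ℕ} (N : Matrix (Fin (d + 1)) (Fin (d + 1)) ℝ)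
    (x : EuclideanSpace ℝ (Fin (d + 1))) : EuclideanSpace ℝ (Fin (d + 1)) :=
  WithLp.toLp 2 fun i => (N.mulVec x.ofLp) i / ∑ k, |(N.mulVec x.ofLp) k|

/-- `N_w = N_{w₁} ⋯ N_{wₙ}` for a finite word `w`; the identity for the empty word. -/
def wordMat {d m : ℕ} (N : Fin m → Matrix (Fin (d + 1)) (Fin (d + 1)) ℝ) (w : List (Fin m)) :
    Matrix (Fin (d + 1)) (Fin (d + 1)) ℝ :=
  (w.map N).prod

/-- `T_w = T_{w₁} ∘ ⋯ ∘ T_{wₙ}` for a finite word `w`; the identity for the empty word. -/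
noncomputable def wordMap {d m : ℕ} (N : Fin m → Matrix (Fin (d + 1)) (Fin (d + 1)) ℝ) :
    List (Fin m) → EuclideanSpace ℝ (Fin (d + 1)) → EuclideanSpace ℝ (Fin (d + 1))
  | [] => id
  | j :: w => proj (N j) ∘ wordMap N w

/-- The union of the images `T_w(Δ)` over the words `w` of length `n`. -/
def level {d m : ℕ} (N : Fin m → Matrix (Fin (d + 1)) (Fin (d + 1)) ℝ) (n : ℕ) :
    Set (EuclideanSpace ℝ (Fin (d + 1))) :=
  ⋃ w ∈ {w : List (Fin m) | w.length = n}, wordMap N w '' simplex d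

/-- The self-projective attractor, as the limit set `⋂ₙ ⋃_{|w| = n} T_w(Δ)`. By
`isGreatest_attractor` below it is the largest subset `A` of `Δ` with `A = ⋃ⱼ Tⱼ(A)`. -/
def attractor {d m : ℕ} (N : Fin m → Matrix (Fin (d + 1)) (Fin (d + 1)) ℝ) :
    Set (EuclideanSpace ℝ (Fin (d + 1))) :=
  ⋂ n : ℕ, level N n

/-- `C` is a connected component of the set `A`. -/
def IsComponentOf {X : Type*} [TopologicalSpace X] (C A : Set X) : Prop :=
  ∃ x ∈ A, C = connectedComponentIn A x

/-- A main hole: a connected component of `Δ \ ⋃ⱼ Tⱼ(Δ)`. -/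
def IsMainHole {d m : ℕ} (N : Fin m → Matrix (Fin (d + 1)) (Fin (d + 1)) ℝ)
    (H : Set (EuclideanSpace ℝ (Fin (d + 1)))) : Prop :=
  IsComponentOf H (simplex d \ ⋃ j, proj (N j) '' simplex d)

/-- `H` is the interior, relative to the hyperplane, of a non-degenerate `d`-simplex in it. -/
def IsInteriorOfSimplex {d : ℕ} (H : Set (EuclideanSpace ℝ (Fin (d + 1)))) : Prop :=
  ∃ v : Fin (d + 1) → EuclideanSpace ℝ (Fin (d + 1)),
    (∀ i, v i ∈ hyperplane d) ∧ AffineIndependent ℝ v ∧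
      H = relInterior (convexHull ℝ (range v))

/-- `d`-dimensional Lebesgue measure on the hyperplane, as the `d`-dimensional Hausdorff measure,
normalised so as to agree with Lebesgue measure on `d`-dimensional Euclidean spaces. -/
noncomputable def vol (d : ℕ) : Measure (EuclideanSpace ℝ (Fin (d + 1))) :=
  μHE[d]

/-- The closed `ε`-neighbourhood of `S` inside `Δ`. -/
def nhd {d : ℕ} (S : Set (EuclideanSpace ℝ (Fin (d + 1)))) (ε : ℝ) :
    Set (EuclideanSpace ℝ (Fin (d + 1))) :=
  {x ∈ simplex d | ∃ y ∈ S, ‖x - y‖ ≤ ε}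

/-- The upper box-counting (Minkowski) dimension of a closed subset `S` of `Δ`, namely
`d - liminf_{ε → 0+} log (vol S_ε) / log ε`, as an extended real number. -/
noncomputable def upperBoxDim {d : ℕ} (S : Set (EuclideanSpace ℝ (Fin (d + 1)))) : EReal :=
  (d : EReal) -
    liminf (fun ε : ℝ => ENNReal.log (vol d (nhd S ε)) / ((Real.log ε : ℝ) : EReal)) (𝓝[>] 0)

/-! The attractor is the largest invariant subset of the simplex. -/

theorem sum_mulVec_pos {d : ℕ} {N : Matrix (Fin (d + 1)) (Fin (d + 1)) ℝ} (hN : IsAdmissible N)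
    {x : EuclideanSpace ℝ (Fin (d + 1))} (hx : x ∈ simplex d) :
    0 < ∑ k, |(N.mulVec x.ofLp) k| := by
  refine lt_of_le_of_ne (Finset.sum_nonneg fun k _ => abs_nonneg _) fun h => ?_
  have h0 : ∀ k, (N.mulVec x.ofLp) k = 0 := fun k => by
    have := (Finset.sum_eq_zero_iff_of_nonneg (fun k _ => abs_nonneg _)).1 h.symm k
      (Finset.mem_univ k)
    simpa using this
  have hdet : N.det ≠ 0 := by rcases hN.2 with h | h <;> rw [h] <;> norm_num
  have h1 : x.ofLp = 0 := Matrix.eq_zero_of_mulVec_eq_zero hdet (funext h0)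
  have h2 := hx.2
  simp [h1] at h2

theorem proj_mem {d : ℕ} {N : Matrix (Fin (d + 1)) (Fin (d + 1)) ℝ} (hN : IsAdmissible N)
    {x : EuclideanSpace ℝ (Fin (d + 1))} (hx : x ∈ simplex d) : proj N x ∈ simplex d := by
  have hpos := sum_mulVec_pos hN hx
  have hnn : ∀ k, 0 ≤ (N.mulVec x.ofLp) k := fun k => by
    rw [Matrix.mulVec, dotProduct]
    exact Finset.sum_nonneg fun j _ => mul_nonneg (hN.1 k j) (hx.1 j)
  refine ⟨fun i => div_nonneg (hnn i) hpos.le, ?_⟩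
  simp only [proj]
  rw [← Finset.sum_div, div_eq_one_iff_eq hpos.ne']
  exact Finset.sum_congr rfl fun k _ => (abs_of_nonneg (hnn k)).symm

theorem proj_injOn {d : ℕ} {N : Matrix (Fin (d + 1)) (Fin (d + 1)) ℝ} (hN : IsAdmissible N) :
    InjOn (proj N) (simplex d) := by
  intro x hx y hy hxy
  have hdet : N.det ≠ 0 := by rcases hN.2 with h | h <;> rw [h] <;> norm_num
  have ha := sum_mulVec_pos hN hx
  have hb := sum_mulVec_pos hN hy
  set a := ∑ k, |(N.mulVec x.ofLp) k| with hadef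
  set b := ∑ k, |(N.mulVec y.ofLp) k| with hbdef
  have h1 : N.mulVec (b • x.ofLp - a • y.ofLp) = 0 := by
    rw [Matrix.mulVec_sub, Matrix.mulVec_smul, Matrix.mulVec_smul]
    funext i
    have h2 : (N.mulVec x.ofLp) i / a = (N.mulVec y.ofLp) i / b :=
      congrArg (fun z : EuclideanSpace ℝ (Fin (d + 1)) => z i) hxy
    rw [div_eq_div_iff ha.ne' hb.ne'] at h2
    simp only [Pi.sub_apply, Pi.smul_apply, smul_eq_mul, Pi.zero_apply]
    linarith
  have h2 := Matrix.eq_zero_of_mulVec_eq_zero hdet h1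
  have h3 : ∀ i, b * x i = a * y i := fun i => by
    have := congrFun h2 i
    simp only [Pi.sub_apply, Pi.smul_apply, smul_eq_mul, Pi.zero_apply] at this
    linarith
  have hab : b = a := by
    have h4 : ∑ i, b * x i = ∑ i, a * y i := Finset.sum_congr rfl fun i _ => h3 i
    rw [← Finset.mul_sum, ← Finset.mul_sum, hx.2, hy.2] at h4
    linarith
  ext i
  have h5 := h3 i
  rw [hab] at h5
  exact mul_left_cancel₀ ha.ne' h5

theorem level_zero {d m : ℕ} (N : Fin m → Matrix (Fin (d + 1)) (Fin (d + 1)) ℝ) :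
    level N 0 = simplex d := by
  simp [level, wordMap]

theorem level_succ {d m : ℕ} (N : Fin m → Matrix (Fin (d + 1)) (Fin (d + 1)) ℝ) (n : ℕ) :
    level N (n + 1) = ⋃ j, proj (N j) '' level N n := by
  ext x
  simp only [level, mem_iUnion, mem_ofPred_eq, exists_prop, mem_image]
  constructor
  · rintro ⟨w, hw, y, hy, rfl⟩
    obtain ⟨j, w, rfl⟩ := List.exists_cons_of_length_eq_add_one hw
    exact ⟨j, wordMap N w y, ⟨w, by simpa using hw, y, hy, rfl⟩, rfl⟩
  · rintro ⟨j, _, ⟨w, hw, y, hy, rfl⟩, rfl⟩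
    exact ⟨j :: w, by simpa using hw, y, hy, rfl⟩

theorem level_succ_subset {d m : ℕ} {N : Fin m → Matrix (Fin (d + 1)) (Fin (d + 1)) ℝ}
    (hN : ∀ j, IsAdmissible (N j)) (n : ℕ) : level N (n + 1) ⊆ level N n := by
  induction n with
  | zero =>
    rw [level_succ, level_zero]
    exact iUnion_subset fun j => image_subset_iff.2 fun x hx => proj_mem (hN j) hx
  | succ n ih =>
    rw [level_succ N (n + 1), level_succ N n]
    exact iUnion_mono fun j => image_mono (level_succ N n ▸ ih)

theorem isGreatest_attractor {d m : ℕ} {N : Fin m → Matrix (Fin (d + 1)) (Fin (d + 1)) ℝ}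
    (hN : ∀ j, IsAdmissible (N j)) :
    IsGreatest {A | A ⊆ simplex d ∧ A = ⋃ j, proj (N j) '' A} (attractor N) := by
  have hanti : Antitone (level N) := antitone_nat_of_succ_le (level_succ_subset hN)
  have hsub : ∀ n, level N n ⊆ simplex d := fun n => level_zero N ▸ hanti (Nat.zero_le n)
  refine ⟨⟨(iInter_subset _ 0).trans (hsub 0), ?_⟩, ?_⟩
  · apply Subset.antisymm
    · intro x hx
      have hx' : ∀ n, ∃ j, x ∈ proj (N j) '' level N n := fun n => by
        have := mem_iInter.1 hx (n + 1)
        rw [level_succ] at this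
        exact mem_iUnion.1 this
      obtain ⟨j, hj⟩ : ∃ j, ∀ n, x ∈ proj (N j) '' level N n := by
        by_contra! hcon
        choose k hk using hcon
        obtain ⟨j, hj⟩ := hx' (Finset.univ.sup k)
        exact hk j (image_mono (hanti (Finset.le_sup (Finset.mem_univ j))) hj)
      obtain ⟨y, hy, rfl⟩ := hj 0
      refine mem_iUnion.2 ⟨j, y, mem_iInter.2 fun n => ?_, rfl⟩
      obtain ⟨z, hz, hzy⟩ := hj n
      rwa [← proj_injOn (hN j) (hsub n hz) (hsub 0 hy) hzy]
    · refine iUnion_subset fun j => image_subset_iff.2 fun y hy => mem_iInter.2 fun n => ?_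
      refine level_succ_subset hN n ?_
      rw [level_succ]
      exact mem_iUnion.2 ⟨j, mem_image_of_mem _ (mem_iInter.1 hy n)⟩
  · rintro A ⟨hA, hAeq⟩
    refine subset_iInter fun n => ?_
    induction n with
    | zero => rwa [level_zero]
    | succ n ih =>
      rw [hAeq, level_succ]
      exact iUnion_mono fun j => image_mono ih

end SelfProjective

open scoped Pointwise

namespace SelfProjective

/-! Everything is lifted from the simplex to cones in `ℝ^(d+1)`, where the maps become linear and,
having determinant `±1`, preserve Lebesgue measure. Let `H` be the open cone over the main holes
(`holeCone`). Its images under distinct words are disjoint (`pairwise_disjoint_image_holeCone`).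
Below height one, the image under `w` has volume at least a constant times `‖N_w‖^(-(d+1))`, since
it contains the image of `H` cut at height `1 / ‖N_w‖` (`volume_truncate_image_ge`). Packing these
images into the truncated orthant bounds the number of words with norm at most `T` by a multiple of
`T^(d+1)` (`exists_card_le_entrySum`).

For the limits, concatenating words whose norms are at most `S` and `T` gives a norm of order at
most `S * T`. Concatenation is injective once the first factor runs over a prefix-free set, and
appending single letters turns any finite set of words into such a set without loss of cardinality
(`exists_prefixFree_card_le`). The count is therefore supermultiplicative up to a dilation, and
Fekete's lemma yields a growth rate `ρ` (`exists_tendsto_log_div_log`). Dyadic summation and a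
Markov inequality identify `ρ` with the critical exponent.

For the dimension, the boundary of `Δ` lies in the attractor, hence so does the boundary of every
hole image (`frontier_image_holeCone_subset`). A hole image either lies wholly in the
`ε`-neighbourhood of the attractor, or contains a ball of radius `ε / 2` inside that neighbourhood
(`vol_nhd_inter_holeImage_ge`). With `T = ε^(-d/(d+1))`, each word of norm at most `T` thus
contributes volume of order at least `ε^d`, which gives the bound `d * ρ / (d + 1)`. The bound `d -
1` comes from a single facet of `Δ`, and the bound `(d - 1) / d * ρ` follows because `d ^ 2 - 1 ≤ d
^ 2`. -/

/-! ### Prefix-free sets of words and supermultiplicative counting -/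

/-- Insert words in order of length. A new longest word `w` has at most one prefix `p` in the set
built so far. If there is one, it is traded for the two words `wa` and `wb`; otherwise `wa` is
added. Either way the cardinality grows by one. -/
theorem exists_prefixFree_card_le {α : Type*} {a b : α} (hab : a ≠ b)
    (S : Finset (List α)) :
    ∃ M : Finset (List α), (∀ p ∈ M, ∃ u ∈ S, ∃ c, p = u ++ [c]) ∧
      (∀ p ∈ M, ∀ q ∈ M, p <+: q → p = q) ∧ S.card ≤ M.card := by
  classical
  induction S using Finset.induction_on_max_value (fun w : List α => w.length) with
  | empty => exact ⟨∅, by simp⟩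
  | insert w S hw hmax ih =>
    obtain ⟨M, hM, hfree, hcard⟩ := ih
    have hne : ∀ q ∈ M, ∀ c, q ≠ w ++ [c] := by
      rintro q hq c rfl
      obtain ⟨u, hu, c', h⟩ := hM _ hq
      rw [List.append_singleton_inj] at h
      exact hw (h.1 ▸ hu)
    -- Elements of `M` have length at most that of `w` plus one, so a prefix relation here would be
    -- an equality.
    have hnp : ∀ q ∈ M, ∀ c, ¬ (w ++ [c] <+: q) := by
      intro q hq c h
      obtain ⟨u, hu, c', rfl⟩ := hM _ hq
      refine hne _ hq c (h.eq_of_length ?_).symm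
      have h1 := h.length_le
      have h2 := hmax u hu
      simp only [List.length_append, List.length_singleton] at h1 ⊢
      omega
    have hpw : ∀ q ∈ M, ∀ c, q <+: w ++ [c] → q <+: w := by
      intro q hq c h
      rcases List.prefix_concat_iff.1 h with h | h
      · exact absurd h (hne q hq c)
      · exact h
    have hcc : ∀ c c', w ++ [c] <+: w ++ [c'] → c = c' := by
      intro c c' h
      simpa using h
    by_cases hex : ∃ p ∈ M, p <+: w
    · obtain ⟨p, hp, hpw'⟩ := hex
      have huniq : ∀ q ∈ M, q <+: w → q = p := by
        intro q hq hqw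
        rcases List.prefix_or_prefix_of_prefix hqw hpw' with h | h
        · exact hfree q hq p hp h
        · exact (hfree p hp q hq h).symm
      refine ⟨insert (w ++ [a]) (insert (w ++ [b]) (M.erase p)), ?_, ?_, ?_⟩
      · intro q hq
        simp only [Finset.mem_insert, Finset.mem_erase] at hq
        rcases hq with rfl | rfl | ⟨-, hq⟩
        · exact ⟨w, by simp, a, rfl⟩
        · exact ⟨w, by simp, b, rfl⟩
        · obtain ⟨u, hu, c, rfl⟩ := hM q hq
          exact ⟨u, by simp [hu], c, rfl⟩
      · intro q hq r hr hqr
        simp only [Finset.mem_insert, Finset.mem_erase] at hq hr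
        rcases hq with rfl | rfl | ⟨hqp, hq⟩ <;> rcases hr with rfl | rfl | ⟨hrp, hr⟩
        · rfl
        · rw [hcc _ _ hqr]
        · exact absurd hqr (hnp r hr a)
        · rw [hcc _ _ hqr]
        · rfl
        · exact absurd hqr (hnp r hr b)
        · exact absurd (huniq q hq (hpw q hq _ hqr)) hqp
        · exact absurd (huniq q hq (hpw q hq _ hqr)) hqp
        · exact hfree q hq r hr hqr
      · have h1 : w ++ [b] ∉ M.erase p := fun h => hne _ (Finset.mem_of_mem_erase h) b rfl
        have h2 : w ++ [a] ∉ insert (w ++ [b]) (M.erase p) := by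
          intro h
          rcases Finset.mem_insert.1 h with h | h
          · exact hab (by simpa using h)
          · exact hne _ (Finset.mem_of_mem_erase h) a rfl
        rw [Finset.card_insert_of_notMem hw, Finset.card_insert_of_notMem h2,
          Finset.card_insert_of_notMem h1, Finset.card_erase_of_mem hp]
        omega
    · push Not at hex
      refine ⟨insert (w ++ [a]) M, ?_, ?_, ?_⟩
      · intro q hq
        rcases Finset.mem_insert.1 hq with rfl | hq
        · exact ⟨w, by simp, a, rfl⟩
        · obtain ⟨u, hu, c, rfl⟩ := hM q hq
          exact ⟨u, by simp [hu], c, rfl⟩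
      · intro q hq r hr hqr
        rcases Finset.mem_insert.1 hq with rfl | hq <;> rcases Finset.mem_insert.1 hr with rfl | hr
        · rfl
        · exact absurd hqr (hnp r hr a)
        · exact absurd (hpw q hq _ hqr) (hex q hq)
        · exact hfree q hq r hr hqr
      · have h1 : w ++ [a] ∉ M := fun h => hne _ h a rfl
        rw [Finset.card_insert_of_notMem hw, Finset.card_insert_of_notMem h1]
        omega

/-- The number of indices at which `L` is at most `T`. -/
noncomputable def count {ι : Type*} (L : ι → ℝ) (T : ℝ) : ℕ := {w | L w ≤ T}.ncard

theorem count_mono {ι : Type*} {L : ι → ℝ} (hfin : ∀ T, {w | L w ≤ T}.Finite) :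
    Monotone (count L) := fun _ T h =>
  ncard_le_ncard (fun _ hw => le_trans hw h) (hfin T)

/-- Concatenation is injective when the first factor comes from a prefix-free set. `K` pays for the
letter appended to reach such a set, `C` for the concatenation. -/
theorem count_mul_count_le {α : Type*} [Nontrivial α] {L : List α → ℝ}
    (hfin : ∀ T, {w | L w ≤ T}.Finite) (hL : ∀ w, 0 ≤ L w) {K C : ℝ} (hC : 0 ≤ C) (hK0 : 0 ≤ K)
    (hK : ∀ w a, L (w ++ [a]) ≤ K * L w) (hmul : ∀ u v, L (u ++ v) ≤ C * L u * L v) (S T : ℝ) :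
    count L S * count L T ≤ count L (C * K * S * T) := by
  classical
  obtain ⟨a, b, hab⟩ := exists_pair_ne α
  obtain ⟨M, hM, hfree, hcard⟩ := exists_prefixFree_card_le hab (hfin S).toFinset
  have h1 : count L S ≤ M.card := by
    rw [count, ncard_eq_toFinset_card _ (hfin S)]
    exact hcard
  refine (Nat.mul_le_mul_right _ h1).trans ?_
  rw [count, ncard_eq_toFinset_card _ (hfin T), ← Finset.card_product, count,
    ncard_eq_toFinset_card _ (hfin _)]
  refine Finset.card_le_card_of_injOn (fun p => p.1 ++ p.2) ?_ ?_
  · rintro ⟨u, v⟩ huv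
    simp only [Finset.coe_product, mem_prod, Finset.mem_coe, Finite.mem_toFinset,
      mem_ofPred_eq] at huv ⊢
    obtain ⟨u', hu', c, rfl⟩ := hM u huv.1
    have hu'' : L u' ≤ S := by simpa using hu'
    have h2 : L (u' ++ [c]) ≤ K * S := (hK _ _).trans (mul_le_mul_of_nonneg_left hu'' hK0)
    calc L (u' ++ [c] ++ v) ≤ C * L (u' ++ [c]) * L v := hmul _ _
      _ ≤ C * (K * S) * T := mul_le_mul (mul_le_mul_of_nonneg_left h2 hC) huv.2 (hL _)
          (mul_nonneg hC ((hL _).trans h2))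
      _ = C * K * S * T := by ring
  · rintro ⟨u, v⟩ huv ⟨u', v'⟩ huv' h
    simp only [Finset.coe_product, mem_prod, Finset.mem_coe] at huv huv' h
    have h3 : u = u' := by
      rcases List.prefix_or_prefix_of_prefix (List.prefix_append u v)
        (h ▸ List.prefix_append u' v') with h4 | h4
      · exact hfree _ huv.1 _ huv'.1 h4
      · exact (hfree _ huv'.1 _ huv.1 h4).symm
    subst h3
    simpa using h

/-! ### Existence of the growth rate -/

/-- A form of Fekete's lemma for monotone functions that are supermultiplicative up to a
dilation and of polynomial growth. -/
theorem exists_tendsto_log_div_log {f : ℝ → ℕ} (hmono : Monotone f) {κ : ℝ} (hκ : 0 < κ)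
    (hmul : ∀ x y, f x * f y ≤ f (κ * x * y)) {x₀ : ℝ} (hx₀ : f x₀ ≠ 0) {A : ℝ} {D : ℕ}
    (hbd : ∀ x, 1 ≤ x → (f x : ℝ) ≤ A * x ^ D) :
    ∃ ρ : ℝ, 0 ≤ ρ ∧ Tendsto (fun T : ℝ => Real.log (f T) / Real.log T) atTop (𝓝 ρ) := by
  have hpos : ∀ x, x₀ ≤ x → (1 : ℝ) ≤ f x := fun x hx => by
    exact_mod_cast (Nat.one_le_iff_ne_zero.2 hx₀).trans (hmono hx)
  -- Sampling at `κ⁻¹ * B ^ n` absorbs the dilation `κ`, and `B ≥ κ * x₀` keeps the sample points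
  -- with `n ≥ 1` in the range where `f ≥ 1`.
  set B : ℝ := max 2 (κ * x₀) with hB
  have hB2 : 2 ≤ B := le_max_left _ _
  have hB0 : 0 < B := by linarith
  have hlogB : 0 < Real.log B := Real.log_pos (by linarith)
  have hge : ∀ n : ℕ, n ≠ 0 → x₀ ≤ κ⁻¹ * B ^ n := by
    intro n hn
    have h1 : κ * x₀ ≤ B ^ n := (le_max_right _ _).trans (le_self_pow₀ (by linarith) hn)
    rw [inv_mul_eq_div, le_div_iff₀ hκ]
    linarith
  set v : ℕ → ℝ := fun n => Real.log (f (κ⁻¹ * B ^ n)) with hv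
  have hprod : ∀ n k, f (κ⁻¹ * B ^ n) * f (κ⁻¹ * B ^ k) ≤ f (κ⁻¹ * B ^ (n + k)) := by
    intro n k
    refine (hmul _ _).trans (le_of_eq ?_)
    congr 1
    rw [pow_add]
    field_simp
  -- The point `κ⁻¹` may lie below `x₀`. Its value is at least its own square, so it is `0` or `1`,
  -- and the logarithm is `0` in both cases because `Real.log 0 = 0`.
  have hv0 : v 0 = 0 := by
    have h1 := hprod 0 0
    simp only [hv]
    rcases Nat.eq_zero_or_pos (f (κ⁻¹ * B ^ 0)) with h | h
    · rw [h]; simp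
    · have : f (κ⁻¹ * B ^ 0) = 1 := le_antisymm (Nat.le_of_mul_le_mul_left (by simpa using h1) h) h
      rw [this]; simp
  have hsub : Subadditive fun n => -v n := by
    intro n k
    rcases eq_or_ne n 0 with rfl | hn
    · simp [hv0]
    rcases eq_or_ne k 0 with rfl | hk
    · simp [hv0]
    have h1 := hpos _ (hge n hn)
    have h2 := hpos _ (hge k hk)
    have h3 : v n + v k ≤ v (n + k) := by
      simp only [hv]
      rw [← Real.log_mul (by positivity) (by positivity)]
      exact Real.log_le_log (by positivity) (by exact_mod_cast hprod n k)
    linarith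
  have hbdd : BddBelow (range fun n : ℕ => -v n / n) := by
    set A' := max A 1
    set M := max 1 κ⁻¹
    have hA' : (0 : ℝ) < A' := lt_of_lt_of_le one_pos (le_max_right _ _)
    have hM : 1 ≤ M := le_max_left _ _
    have hlA : 0 ≤ Real.log A' := Real.log_nonneg (le_max_right _ _)
    have hlM : 0 ≤ Real.log M := Real.log_nonneg hM
    refine ⟨-(Real.log A' + D * Real.log M + D * Real.log B), ?_⟩
    rintro _ ⟨n, rfl⟩
    rcases eq_or_ne n 0 with rfl | hn
    · simp only [Nat.cast_zero, div_zero]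
      have : 0 ≤ D * Real.log M := by positivity
      have : 0 ≤ D * Real.log B := by positivity
      linarith
    have hn1 : (1 : ℝ) ≤ n := by exact_mod_cast Nat.one_le_iff_ne_zero.2 hn
    have hBn : 1 ≤ B ^ n := one_le_pow₀ (by linarith)
    have h1 : (f (κ⁻¹ * B ^ n) : ℝ) ≤ A' * (M * B ^ n) ^ D := by
      have h2 : f (κ⁻¹ * B ^ n) ≤ f (M * B ^ n) :=
        hmono (mul_le_mul_of_nonneg_right (le_max_right _ _) (by positivity))
      have h3 := hbd (M * B ^ n) (by nlinarith)
      have h4 : A * (M * B ^ n) ^ D ≤ A' * (M * B ^ n) ^ D :=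
        mul_le_mul_of_nonneg_right (le_max_left _ _) (by positivity)
      exact le_trans (by exact_mod_cast h2) (h3.trans h4)
    have h5 : v n ≤ Real.log A' + D * (Real.log M + n * Real.log B) := by
      have h6 := Real.log_le_log (lt_of_lt_of_le one_pos (hpos _ (hge n hn))) h1
      rwa [Real.log_mul (by positivity) (by positivity), Real.log_pow,
        Real.log_mul (by positivity) (by positivity), Real.log_pow] at h6
    show _ ≤ -v n / n
    rw [le_div_iff₀ (by linarith)]
    have h7 : Real.log A' * 1 ≤ Real.log A' * n := mul_le_mul_of_nonneg_left hn1 hlA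
    have h8 : D * Real.log M * 1 ≤ D * Real.log M * n :=
      mul_le_mul_of_nonneg_left hn1 (by positivity)
    nlinarith
  have hlim := (hsub.tendsto_lim hbdd).neg
  set l := -hsub.lim with hl
  have hvlim : Tendsto (fun n : ℕ => v n / n) atTop (𝓝 l) := by
    refine hlim.congr fun n => ?_
    ring
  -- The number `⌊g T⌋₊` is the index of the last sample point not exceeding `T`; monotonicity then
  -- interpolates between consecutive samples.
  set g : ℝ → ℝ := fun T => Real.log (κ * T) / Real.log B with hg
  have hκT : Tendsto (fun T : ℝ => κ * T) atTop atTop := tendsto_id.const_mul_atTop hκ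
  have hgtop : Tendsto g atTop atTop := (Real.tendsto_log_atTop.comp hκT).atTop_div_const hlogB
  have hn : Tendsto (fun T => ⌊g T⌋₊) atTop atTop := tendsto_nat_floor_atTop.comp hgtop
  have hloginv : Tendsto (fun T : ℝ => (Real.log T)⁻¹) atTop (𝓝 0) :=
    tendsto_inv_atTop_zero.comp Real.tendsto_log_atTop
  have hglog : Tendsto (fun T => g T / Real.log T) atTop (𝓝 (1 / Real.log B)) := by
    have h1 : Tendsto (fun T : ℝ => (Real.log κ * (Real.log T)⁻¹ + 1) / Real.log B) atTop
        (𝓝 ((Real.log κ * 0 + 1) / Real.log B)) :=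
      ((hloginv.const_mul _).add_const 1).div_const _
    rw [mul_zero, zero_add] at h1
    refine h1.congr' ?_
    filter_upwards [eventually_gt_atTop 1] with T hT
    have := Real.log_pos hT
    simp only [hg]
    rw [Real.log_mul hκ.ne' (by linarith)]
    field_simp
  have hnlog : Tendsto (fun T => (⌊g T⌋₊ : ℝ) / Real.log T) atTop (𝓝 (1 / Real.log B)) := by
    have h1 := ((tendsto_nat_floor_div_atTop (R := ℝ)).comp hgtop).mul hglog
    rw [one_mul] at h1
    refine h1.congr' ?_
    filter_upwards [hgtop.eventually_gt_atTop 0] with T hT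
    simp only [Function.comp]
    field_simp
  have hn1log : Tendsto (fun T => ((⌊g T⌋₊ + 1 : ℕ) : ℝ) / Real.log T) atTop
      (𝓝 (1 / Real.log B)) := by
    have h1 := hnlog.add hloginv
    rw [add_zero] at h1
    refine h1.congr fun T => ?_
    push_cast
    ring
  have hlow : Tendsto (fun T => v ⌊g T⌋₊ / Real.log T) atTop (𝓝 (l * (1 / Real.log B))) := by
    refine ((hvlim.comp hn).mul hnlog).congr' ?_
    filter_upwards [hn.eventually_ge_atTop 1] with T hT
    have : (0 : ℝ) < ⌊g T⌋₊ := by exact_mod_cast hT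
    simp only [Function.comp]
    field_simp
  have hup : Tendsto (fun T => v (⌊g T⌋₊ + 1) / Real.log T) atTop (𝓝 (l * (1 / Real.log B))) := by
    refine ((hvlim.comp ((tendsto_add_atTop_nat 1).comp hn)).mul hn1log).congr fun T => ?_
    have : (0 : ℝ) < ((⌊g T⌋₊ + 1 : ℕ) : ℝ) := by positivity
    simp only [Function.comp]
    field_simp
  have hev : ∀ᶠ T in atTop, v ⌊g T⌋₊ ≤ Real.log (f T) ∧ Real.log (f T) ≤ v (⌊g T⌋₊ + 1) := by
    filter_upwards [hn.eventually_ge_atTop 1, eventually_gt_atTop 0,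
      hgtop.eventually_ge_atTop 0] with T hT hT0 hg0
    have hκT0 : 0 < κ * T := by positivity
    have h1 : B ^ ⌊g T⌋₊ ≤ κ * T := by
      rw [← Real.log_le_log_iff (by positivity) hκT0, Real.log_pow, ← le_div_iff₀ hlogB]
      exact Nat.floor_le hg0
    have h2 : κ * T ≤ B ^ (⌊g T⌋₊ + 1) := by
      rw [← Real.log_le_log_iff hκT0 (by positivity), Real.log_pow, ← div_le_iff₀ hlogB]
      push_cast
      exact (Nat.lt_floor_add_one _).le
    have h3 : κ⁻¹ * B ^ ⌊g T⌋₊ ≤ T := by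
      rw [inv_mul_eq_div, div_le_iff₀ hκ]; linarith
    have h4 : T ≤ κ⁻¹ * B ^ (⌊g T⌋₊ + 1) := by
      rw [inv_mul_eq_div, le_div_iff₀ hκ]; linarith
    have h5 := hpos _ (hge _ (Nat.one_le_iff_ne_zero.1 hT))
    have h6 : (1 : ℝ) ≤ f T := h5.trans (by exact_mod_cast hmono h3)
    exact ⟨Real.log_le_log (by linarith) (by exact_mod_cast hmono h3),
      Real.log_le_log (by linarith) (by exact_mod_cast hmono h4)⟩
  have hmain : Tendsto (fun T : ℝ => Real.log (f T) / Real.log T) atTop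
      (𝓝 (l * (1 / Real.log B))) := by
    refine tendsto_of_tendsto_of_tendsto_of_le_of_le' hlow hup ?_ ?_
    · filter_upwards [hev, eventually_gt_atTop 1] with T hT hT1
      exact div_le_div_of_nonneg_right hT.1 (Real.log_pos hT1).le
    · filter_upwards [hev, eventually_gt_atTop 1] with T hT hT1
      exact div_le_div_of_nonneg_right hT.2 (Real.log_pos hT1).le
  refine ⟨_, ge_of_tendsto hmain ?_, hmain⟩
  filter_upwards [eventually_ge_atTop x₀, eventually_gt_atTop 1] with T hT hT1
  exact div_nonneg (Real.log_nonneg (hpos T hT)) (Real.log_pos hT1).le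

/-! ### Growth rate and critical exponent -/

theorem summable_rpow_neg {ι : Type*} {L : ι → ℝ} (hL : ∀ w, 0 < L w)
    (hfin : ∀ T, {w | L w ≤ T}.Finite) {ρ r : ℝ} (hρ : 0 ≤ ρ) (hr : ρ < r)
    (hlim : Tendsto (fun T : ℝ => Real.log (count L T) / Real.log T) atTop (𝓝 ρ)) :
    Summable fun w => L w ^ (-r) := by
  obtain ⟨s, hs, hsr⟩ := exists_between hr
  -- Dyadic shells. The natural floor puts every index with `L w < 2` into shell `0`, so the lower
  -- bound on `L` is available only from shell `1` on.
  set sh : ℕ → Set ι := fun n => {w | ⌊Real.logb 2 (L w)⌋₊ = n} with hsh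
  have hlt : ∀ n, ∀ w ∈ sh n, L w ≤ 2 ^ (n + 1) := by
    intro n w hw
    have h1 := (Nat.lt_floor_add_one (Real.logb 2 (L w))).le
    rw [show ⌊Real.logb 2 (L w)⌋₊ = n from hw, Real.logb_le_iff_le_rpow (by norm_num) (hL w)] at h1
    exact_mod_cast h1
  have hge : ∀ n, 1 ≤ n → ∀ w ∈ sh n, (2 : ℝ) ^ n ≤ L w := by
    intro n hn w hw
    have h1 : (n : ℝ) ≤ Real.logb 2 (L w) := by
      have h2 : ⌊Real.logb 2 (L w)⌋₊ ≠ 0 := by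
        rw [show ⌊Real.logb 2 (L w)⌋₊ = n from hw]; omega
      have h3 := Nat.floor_le (Nat.pos_of_floor_pos (Nat.pos_of_ne_zero h2)).le
      rwa [show ⌊Real.logb 2 (L w)⌋₊ = n from hw] at h3
    rw [Real.le_logb_iff_rpow_le (by norm_num) (hL w)] at h1
    exact_mod_cast h1
  have hshfin : ∀ n, (sh n).Finite := fun n => (hfin (2 ^ (n + 1))).subset (hlt n)
  rw [summable_partition (fun w => Real.rpow_nonneg (hL w).le _) (s := sh)
    (fun w => ⟨_, rfl, fun _ h => Eq.symm h⟩)]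
  refine ⟨fun n => ?_, ?_⟩
  · have := (hshfin n).to_subtype
    exact Summable.of_finite
  have hev : ∀ᶠ n : ℕ in atTop, (count L (2 ^ (n + 1)) : ℝ) ≤ ((2 : ℝ) ^ (n + 1)) ^ s := by
    have h1 : Tendsto (fun n : ℕ => (2 : ℝ) ^ (n + 1)) atTop atTop :=
      (tendsto_pow_atTop_atTop_of_one_lt (by norm_num)).comp (tendsto_add_atTop_nat 1)
    filter_upwards [h1.eventually (hlim.eventually_lt_const hs)] with n hn
    rw [div_lt_iff₀ (Real.log_pos (one_lt_pow₀ (by norm_num) (by omega)))] at hn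
    rcases Nat.eq_zero_or_pos (count L (2 ^ (n + 1))) with h | h
    · rw [h]; push_cast; positivity
    · refine Real.le_rpow_of_log_le (by positivity) ?_
      exact hn.le
  have hgeom : Summable fun n : ℕ => (2 : ℝ) ^ s * ((2 : ℝ) ^ (s - r)) ^ n :=
    (summable_geometric_of_lt_one (by positivity)
      (Real.rpow_lt_one_of_one_lt_of_neg (by norm_num) (by linarith))).mul_left _
  refine hgeom.of_norm_bounded_eventually_nat ?_
  filter_upwards [hev, eventually_ge_atTop 1] with n hn hn1
  have := (hshfin n).fintype
  rw [tsum_fintype, Real.norm_of_nonneg (Finset.sum_nonneg fun w _ => Real.rpow_nonneg (hL _).le _)]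
  calc ∑ w : sh n, L w ^ (-r) ≤ ∑ _w : sh n, ((2 : ℝ) ^ n) ^ (-r) :=
        Finset.sum_le_sum fun w _ => Real.rpow_le_rpow_of_nonpos (by positivity)
          (hge n hn1 w w.2) (by linarith)
    _ = (sh n).ncard * ((2 : ℝ) ^ n) ^ (-r) := by
        rw [Finset.sum_const, nsmul_eq_mul, Finset.card_univ, ← Nat.card_eq_fintype_card]
        rfl
    _ ≤ ((2 : ℝ) ^ (n + 1)) ^ s * ((2 : ℝ) ^ n) ^ (-r) := by
        refine mul_le_mul_of_nonneg_right (le_trans ?_ hn) (by positivity)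
        exact_mod_cast ncard_le_ncard (hlt n) (hfin _)
    _ = (2 : ℝ) ^ s * ((2 : ℝ) ^ (s - r)) ^ n := by
        rw [← Real.rpow_natCast, ← Real.rpow_natCast, ← Real.rpow_natCast, ← Real.rpow_mul,
          ← Real.rpow_mul, ← Real.rpow_mul, ← Real.rpow_add, ← Real.rpow_add]
        · congr 1; push_cast; ring
        all_goals norm_num

/-- Markov's inequality: each index counted at `T` contributes at least `T ^ (-r)` to the convergent
sum, so the count is `O(T ^ r)`. -/
theorem le_of_summable_rpow_neg {ι : Type*} {L : ι → ℝ} (hL : ∀ w, 0 < L w)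
    (hfin : ∀ T, {w | L w ≤ T}.Finite) {ρ r : ℝ} (hr : 0 ≤ r)
    (hlim : Tendsto (fun T : ℝ => Real.log (count L T) / Real.log T) atTop (𝓝 ρ))
    (hsum : Summable fun w => L w ^ (-r)) : ρ ≤ r := by
  set A := ∑' w, L w ^ (-r) + 1
  have hA0 : 0 ≤ ∑' w, L w ^ (-r) := tsum_nonneg fun w => Real.rpow_nonneg (hL w).le _
  have hA : 0 < A := by positivity
  have hbd : ∀ T : ℝ, 0 < T → (count L T : ℝ) ≤ A * T ^ r := by
    intro T hT
    have h1 : (count L T : ℝ) * T ^ (-r) ≤ A := by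
      rw [count, ncard_eq_toFinset_card _ (hfin T), ← nsmul_eq_mul, ← Finset.sum_const]
      calc _ ≤ ∑ w ∈ (hfin T).toFinset, L w ^ (-r) := Finset.sum_le_sum fun w hw =>
            Real.rpow_le_rpow_of_nonpos (hL w) (by simpa using hw) (by linarith)
        _ ≤ ∑' w, L w ^ (-r) := hsum.sum_le_tsum _ fun w _ => Real.rpow_nonneg (hL w).le _
        _ ≤ A := by simp [A]
    rwa [Real.rpow_neg hT.le, ← div_eq_mul_inv, div_le_iff₀ (by positivity)] at h1
  have hlog' : Tendsto (fun T : ℝ => |Real.log A| * (Real.log T)⁻¹ + r) atTop (𝓝 r) := by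
    simpa using ((tendsto_inv_atTop_zero.comp Real.tendsto_log_atTop).const_mul
      |Real.log A|).add_const r
  refine le_of_tendsto_of_tendsto hlim hlog' ?_
  filter_upwards [eventually_gt_atTop 1] with T hT
  have hT' := Real.log_pos hT
  have h3 : Real.log (count L T) ≤ |Real.log A| + r * Real.log T := by
    rcases Nat.eq_zero_or_pos (count L T) with h | h
    · rw [h]; simp only [Nat.cast_zero, Real.log_zero]; positivity
    · have h2 := Real.log_le_log (by exact_mod_cast h) (hbd T (by linarith))
      rw [Real.log_mul hA.ne' (by positivity), Real.log_rpow (by linarith)] at h2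
      linarith [le_abs_self (Real.log A)]
  rw [div_le_iff₀ hT']
  field_simp
  linarith

/-! ### Orthants and the linear action of admissible matrices -/

/-- The closed orthant of vectors with non-negative coordinates. -/
def orthant (n : ℕ) : Set (Fin n → ℝ) := {y | ∀ i, 0 ≤ y i}

/-- The open orthant of vectors with positive coordinates. -/
def openOrthant (n : ℕ) : Set (Fin n → ℝ) := {y | ∀ i, 0 < y i}

theorem isOpen_openOrthant (n : ℕ) : IsOpen (openOrthant n) := by
  have : openOrthant n = ⋂ i, {y | 0 < y i} := by ext; simp [openOrthant]
  rw [this]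
  exact isOpen_iInter_of_finite fun i => isOpen_lt continuous_const (continuous_apply i)

theorem isClosed_orthant (n : ℕ) : IsClosed (orthant n) := by
  have : orthant n = ⋂ i, {y | 0 ≤ y i} := by ext; simp [orthant]
  rw [this]
  exact isClosed_iInter fun i => isClosed_le continuous_const (continuous_apply i)

theorem openOrthant_subset (n : ℕ) : openOrthant n ⊆ orthant n := fun _ h i => (h i).le

theorem sum_pos_of_mem_orthant {n : ℕ} {y : Fin n → ℝ} (hy : y ∈ orthant n) (h0 : y ≠ 0) :
    0 < ∑ i, y i := by
  obtain ⟨i, hi⟩ := Function.ne_iff.1 h0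
  exact Finset.sum_pos' (fun i _ => hy i) ⟨i, Finset.mem_univ i, lt_of_le_of_ne (hy i) (Ne.symm hi)⟩

variable {d m : ℕ}

theorem IsAdmissible.det_ne_zero {A : Matrix (Fin (d + 1)) (Fin (d + 1)) ℝ}
    (hA : IsAdmissible A) : A.det ≠ 0 := by
  rcases hA.2 with h | h <;> rw [h] <;> norm_num

theorem IsAdmissible.abs_det {A : Matrix (Fin (d + 1)) (Fin (d + 1)) ℝ}
    (hA : IsAdmissible A) : |A.det| = 1 := by
  rcases hA.2 with h | h <;> rw [h] <;> norm_num

theorem IsAdmissible.mulVec_injective {A : Matrix (Fin (d + 1)) (Fin (d + 1)) ℝ}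
    (hA : IsAdmissible A) : Function.Injective A.mulVec :=
  Matrix.mulVec_injective_of_isUnit ((Matrix.isUnit_iff_isUnit_det A).2 hA.det_ne_zero.isUnit)

theorem IsAdmissible.mulVec_mem {A : Matrix (Fin (d + 1)) (Fin (d + 1)) ℝ}
    (hA : IsAdmissible A) {y : Fin (d + 1) → ℝ} (hy : y ∈ orthant (d + 1)) :
    A.mulVec y ∈ orthant (d + 1) := fun i => by
  rw [Matrix.mulVec, dotProduct]
  exact Finset.sum_nonneg fun j _ => mul_nonneg (hA.1 i j) (hy j)

theorem IsAdmissible.mulVec_ne_zero {A : Matrix (Fin (d + 1)) (Fin (d + 1)) ℝ}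
    (hA : IsAdmissible A) {y : Fin (d + 1) → ℝ} (hy : y ≠ 0) : A.mulVec y ≠ 0 := fun h =>
  hy (Matrix.eq_zero_of_mulVec_eq_zero hA.det_ne_zero h)

theorem IsAdmissible.mulVec_pos {A : Matrix (Fin (d + 1)) (Fin (d + 1)) ℝ}
    (hA : IsAdmissible A) {y : Fin (d + 1) → ℝ} (hy : y ∈ openOrthant (d + 1)) :
    A.mulVec y ∈ openOrthant (d + 1) := by
  intro i
  obtain ⟨j, hj⟩ : ∃ j, A i j ≠ 0 := by
    by_contra! h
    exact hA.det_ne_zero (Matrix.det_eq_zero_of_row_eq_zero i h)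
  exact Finset.sum_pos' (fun j _ => mul_nonneg (hA.1 i j) (hy j).le)
    ⟨j, Finset.mem_univ j, mul_pos (lt_of_le_of_ne (hA.1 i j) hj.symm) (hy j)⟩

/-- Multiplication by an admissible matrix as a homeomorphism. -/
noncomputable def IsAdmissible.homeo {A : Matrix (Fin (d + 1)) (Fin (d + 1)) ℝ}
    (hA : IsAdmissible A) : (Fin (d + 1) → ℝ) ≃ₜ (Fin (d + 1) → ℝ) where
  toFun := A.mulVec
  invFun := A⁻¹.mulVec
  left_inv y := by
    rw [Matrix.mulVec_mulVec, Matrix.nonsing_inv_mul A hA.det_ne_zero.isUnit, Matrix.one_mulVec]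
  right_inv y := by
    rw [Matrix.mulVec_mulVec, Matrix.mul_nonsing_inv A hA.det_ne_zero.isUnit, Matrix.one_mulVec]
  continuous_toFun := continuous_const.matrix_mulVec continuous_id
  continuous_invFun := continuous_const.matrix_mulVec continuous_id

theorem IsAdmissible.coe_homeo {A : Matrix (Fin (d + 1)) (Fin (d + 1)) ℝ}
    (hA : IsAdmissible A) : ⇑hA.homeo = A.mulVec := rfl

theorem IsAdmissible.isOpen_image {A : Matrix (Fin (d + 1)) (Fin (d + 1)) ℝ}
    (hA : IsAdmissible A) {s : Set (Fin (d + 1) → ℝ)} (hs : IsOpen s) :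
    IsOpen (A.mulVec '' s) := by
  rw [← hA.coe_homeo]
  exact hA.homeo.isOpenMap s hs

theorem IsAdmissible.isClosed_image {A : Matrix (Fin (d + 1)) (Fin (d + 1)) ℝ}
    (hA : IsAdmissible A) {s : Set (Fin (d + 1) → ℝ)} (hs : IsClosed s) :
    IsClosed (A.mulVec '' s) := by
  rw [← hA.coe_homeo]
  exact hA.homeo.isClosedMap s hs

theorem IsAdmissible.closure_image {A : Matrix (Fin (d + 1)) (Fin (d + 1)) ℝ}
    (hA : IsAdmissible A) (s : Set (Fin (d + 1) → ℝ)) :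
    closure (A.mulVec '' s) = A.mulVec '' closure s := by
  rw [← hA.coe_homeo, hA.homeo.image_closure]

theorem IsAdmissible.mul {A B : Matrix (Fin (d + 1)) (Fin (d + 1)) ℝ}
    (hA : IsAdmissible A) (hB : IsAdmissible B) : IsAdmissible (A * B) := by
  refine ⟨fun i j => ?_, ?_⟩
  · rw [Matrix.mul_apply]
    exact Finset.sum_nonneg fun k _ => mul_nonneg (hA.1 i k) (hB.1 k j)
  rw [Matrix.det_mul]
  rcases hA.2 with h | h <;> rcases hB.2 with h' | h' <;> rw [h, h'] <;> norm_num

theorem isAdmissible_one : IsAdmissible (1 : Matrix (Fin (d + 1)) (Fin (d + 1)) ℝ) := by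
  refine ⟨fun i j => ?_, Or.inl Matrix.det_one⟩
  rw [Matrix.one_apply]
  split_ifs <;> norm_num

variable {N : Fin m → Matrix (Fin (d + 1)) (Fin (d + 1)) ℝ}

theorem wordMat_nil : wordMat N [] = 1 := rfl

theorem wordMat_cons (j : Fin m) (w : List (Fin m)) :
    wordMat N (j :: w) = N j * wordMat N w := by simp [wordMat]

theorem wordMat_append (u v : List (Fin m)) :
    wordMat N (u ++ v) = wordMat N u * wordMat N v := by simp [wordMat]

theorem isAdmissible_wordMat (hN : ∀ j, IsAdmissible (N j)) (w : List (Fin m)) :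
    IsAdmissible (wordMat N w) := by
  induction w with
  | nil => exact isAdmissible_one
  | cons j w ih => rw [wordMat_cons]; exact (hN j).mul ih

/-! ### Dictionary between the simplex and the cone -/

theorem proj_apply {A : Matrix (Fin (d + 1)) (Fin (d + 1)) ℝ} (hA : IsAdmissible A)
    {x : EuclideanSpace ℝ (Fin (d + 1))} (hx : x ∈ simplex d) :
    (proj A x).ofLp = (∑ k, A.mulVec x.ofLp k)⁻¹ • A.mulVec x.ofLp := by
  have h : ∀ k, |A.mulVec x.ofLp k| = A.mulVec x.ofLp k := fun k =>
    abs_of_nonneg (hA.mulVec_mem hx.1 k)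
  ext i
  simp only [proj, h, Pi.smul_apply, smul_eq_mul]
  rw [div_eq_inv_mul]

theorem proj_mul {A B : Matrix (Fin (d + 1)) (Fin (d + 1)) ℝ} (hA : IsAdmissible A)
    (hB : IsAdmissible B) {x : EuclideanSpace ℝ (Fin (d + 1))} (hx : x ∈ simplex d) :
    proj (A * B) x = proj A (proj B x) := by
  apply WithLp.ofLp_injective
  have hne : x.ofLp ≠ 0 := fun h => by have := hx.2; simp [h] at this
  have hpos := sum_pos_of_mem_orthant (hB.mulVec_mem hx.1) (hB.mulVec_ne_zero hne)
  rw [proj_apply (hA.mul hB) hx, proj_apply hA (proj_mem hB hx), proj_apply hB hx,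
    Matrix.mulVec_smul, Matrix.mulVec_mulVec, smul_smul]
  congr 1
  simp only [Pi.smul_apply, smul_eq_mul]
  rw [← Finset.mul_sum, mul_inv, inv_inv, mul_right_comm, mul_inv_cancel₀ hpos.ne', one_mul]

theorem wordMap_eq_proj (hN : ∀ j, IsAdmissible (N j)) (w : List (Fin m))
    {x : EuclideanSpace ℝ (Fin (d + 1))} (hx : x ∈ simplex d) :
    wordMap N w x = proj (wordMat N w) x := by
  induction w with
  | nil =>
    apply WithLp.ofLp_injective
    rw [proj_apply (isAdmissible_wordMat hN _) hx, wordMat_nil, Matrix.one_mulVec, hx.2]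
    simp [wordMap]
  | cons j w ih =>
    rw [wordMat_cons, proj_mul (hN j) (isAdmissible_wordMat hN w) hx, ← ih]
    rfl

theorem ne_zero_of_sum_eq_one {y : Fin (d + 1) → ℝ} (h : ∑ i, y i = 1) : y ≠ 0 := by
  rintro rfl; simp at h

theorem mem_proj_image_iff {A : Matrix (Fin (d + 1)) (Fin (d + 1)) ℝ} (hA : IsAdmissible A)
    {y : EuclideanSpace ℝ (Fin (d + 1))} (hy : ∑ i, y i = 1) :
    y ∈ proj A '' simplex d ↔ y.ofLp ∈ A.mulVec '' orthant (d + 1) := by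
  constructor
  · rintro ⟨x, hx, rfl⟩
    rw [proj_apply hA hx, ← Matrix.mulVec_smul]
    have h0 : 0 ≤ ∑ k, A.mulVec x.ofLp k := Finset.sum_nonneg fun k _ => hA.mulVec_mem hx.1 k
    exact ⟨_, fun i => mul_nonneg (inv_nonneg.2 h0) (hx.1 i), rfl⟩
  · rintro ⟨z, hz, hzy⟩
    have hz0 : z ≠ 0 := by
      rintro rfl
      rw [Matrix.mulVec_zero] at hzy
      exact ne_zero_of_sum_eq_one hy hzy.symm
    have hpos := sum_pos_of_mem_orthant hz hz0
    have hx : (WithLp.toLp 2 ((∑ i, z i)⁻¹ • z) : EuclideanSpace ℝ (Fin (d + 1))) ∈ simplex d := by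
      refine ⟨fun i => mul_nonneg (inv_nonneg.2 hpos.le) (hz i), ?_⟩
      simp only [Pi.smul_apply, smul_eq_mul]
      rw [← Finset.mul_sum, inv_mul_cancel₀ hpos.ne']
    refine ⟨_, hx, ?_⟩
    apply WithLp.ofLp_injective
    rw [proj_apply hA hx]
    simp only [Matrix.mulVec_smul, hzy, Pi.smul_apply, smul_eq_mul]
    rw [← Finset.mul_sum, hy, mul_one, inv_inv, smul_smul, mul_inv_cancel₀ hpos.ne', one_smul]

/-- The cone over the attractor. -/
def attractorCone (N : Fin m → Matrix (Fin (d + 1)) (Fin (d + 1)) ℝ) : Set (Fin (d + 1) → ℝ) :=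
  {y | ∀ n, ∃ w : List (Fin m), w.length = n ∧ y ∈ (wordMat N w).mulVec '' orthant (d + 1)}

theorem mem_attractor_iff (hN : ∀ j, IsAdmissible (N j))
    {y : EuclideanSpace ℝ (Fin (d + 1))} (hy : ∑ i, y i = 1) :
    y ∈ attractor N ↔ y.ofLp ∈ attractorCone N := by
  have himg : ∀ w, wordMap N w '' simplex d = proj (wordMat N w) '' simplex d := fun w =>
    image_congr fun x hx => wordMap_eq_proj hN w hx
  simp only [attractor, level, mem_iInter, mem_iUnion, mem_ofPred_eq, exists_prop, himg,
    mem_proj_image_iff (isAdmissible_wordMat hN _) hy, attractorCone]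

theorem attractor_subset_simplex (hN : ∀ j, IsAdmissible (N j)) : attractor N ⊆ simplex d :=
  (isGreatest_attractor hN).1.1

theorem mulVec_mem_attractorCone (hN : ∀ j, IsAdmissible (N j)) (w : List (Fin m))
    {y : Fin (d + 1) → ℝ} (hy : y ∈ attractorCone N) :
    (wordMat N w).mulVec y ∈ attractorCone N := by
  induction w with
  | nil => rwa [wordMat_nil, Matrix.one_mulVec]
  | cons j w ih =>
    rw [wordMat_cons, ← Matrix.mulVec_mulVec]
    intro n
    cases n with
    | zero =>
      obtain ⟨u, hu, z, hz, hzy⟩ := ih 0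
      refine ⟨[], rfl, _, (hN j).mulVec_mem ?_, by rw [wordMat_nil, Matrix.one_mulVec]⟩
      rw [← hzy]
      exact (isAdmissible_wordMat hN u).mulVec_mem hz
    | succ n =>
      obtain ⟨u, hu, z, hz, hzy⟩ := ih n
      exact ⟨j :: u, by simp [hu], z, hz, by rw [wordMat_cons, ← Matrix.mulVec_mulVec, hzy]⟩

/-! ### Boundary vectors and the cone over the holes -/

/-- Every non-zero vector on the boundary of the orthant lies in the image of the orthant
under one of the matrices. -/
def CoversBoundary (N : Fin m → Matrix (Fin (d + 1)) (Fin (d + 1)) ℝ) : Prop :=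
  ∀ y ∈ orthant (d + 1), y ∉ openOrthant (d + 1) → y ≠ 0 → ∃ j, y ∈ (N j).mulVec '' orthant (d + 1)

/-- Admissible matrices map the open orthant into itself, so a preimage in the orthant of a boundary
vector is again a boundary vector and the covering can be iterated. -/
theorem CoversBoundary.mem_attractorCone (hN : ∀ j, IsAdmissible (N j)) (hb : CoversBoundary N)
    {y : Fin (d + 1) → ℝ} (hy : y ∈ orthant (d + 1)) (hy' : y ∉ openOrthant (d + 1))
    (h0 : y ≠ 0) : y ∈ attractorCone N := by
  intro n
  induction n generalizing y with
  | zero => exact ⟨[], rfl, y, hy, by rw [wordMat_nil, Matrix.one_mulVec]⟩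
  | succ n ih =>
    obtain ⟨j, z, hz, rfl⟩ := hb y hy hy' h0
    obtain ⟨w, hw, u, hu, rfl⟩ := ih hz (fun h => hy' ((hN j).mulVec_pos h))
      (by rintro rfl; exact h0 (Matrix.mulVec_zero _))
    exact ⟨j :: w, by simp [hw], u, hu, by rw [wordMat_cons, ← Matrix.mulVec_mulVec]⟩

/-- The cone over the union of the main holes. -/
def holeCone (N : Fin m → Matrix (Fin (d + 1)) (Fin (d + 1)) ℝ) : Set (Fin (d + 1) → ℝ) :=
  openOrthant (d + 1) \ ⋃ j, (N j).mulVec '' orthant (d + 1)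

theorem isOpen_holeCone (hN : ∀ j, IsAdmissible (N j)) : IsOpen (holeCone N) :=
  (isOpen_openOrthant _).sdiff
    (isClosed_iUnion_of_finite fun j => (hN j).isClosed_image (isClosed_orthant _))

theorem holeCone_subset : holeCone N ⊆ openOrthant (d + 1) := sdiff_subset

theorem smul_mem_holeCone {y : Fin (d + 1) → ℝ} {t : ℝ} (ht : 0 < t) (hy : y ∈ holeCone N) :
    t • y ∈ holeCone N := by
  refine ⟨fun i => mul_pos ht (hy.1 i), fun h => hy.2 ?_⟩
  obtain ⟨j, z, hz, hzy⟩ := mem_iUnion.1 h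
  refine mem_iUnion.2 ⟨j, t⁻¹ • z, fun i => mul_nonneg (inv_nonneg.2 ht.le) (hz i), ?_⟩
  rw [Matrix.mulVec_smul, hzy, smul_smul, inv_mul_cancel₀ ht.ne', one_smul]

/-- By invariance it suffices to treat `holeCone N` itself. A frontier vector lies on the boundary
of the orthant or in some image `N j (orthant)`. In the second case its preimage is a boundary
vector, since otherwise a whole neighbourhood would be covered and could not meet the holes. -/
theorem frontier_image_holeCone_subset (hN : ∀ j, IsAdmissible (N j)) (hb : CoversBoundary N)
    (w : List (Fin m)) {y : Fin (d + 1) → ℝ} (h0 : y ≠ 0)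
    (hy : y ∈ frontier ((wordMat N w).mulVec '' holeCone N)) : y ∈ attractorCone N := by
  have hw := isAdmissible_wordMat hN w
  rw [(hw.isOpen_image (isOpen_holeCone hN)).frontier_eq, hw.closure_image,
    ← image_sdiff hw.mulVec_injective] at hy
  obtain ⟨z, ⟨hzc, hz⟩, rfl⟩ := hy
  have hz0 : z ≠ 0 := by rintro rfl; exact h0 (Matrix.mulVec_zero _)
  refine mulVec_mem_attractorCone hN w ?_
  have hzo : z ∈ orthant (d + 1) :=
    closure_minimal (holeCone_subset.trans (openOrthant_subset _)) (isClosed_orthant _) hzc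
  by_cases hzp : z ∈ openOrthant (d + 1)
  · have h1 : z ∈ ⋃ j, (N j).mulVec '' orthant (d + 1) := by
      by_contra h; exact hz ⟨hzp, h⟩
    obtain ⟨j, u, hu, rfl⟩ := mem_iUnion.1 h1
    have hu0 : u ≠ 0 := by rintro rfl; exact hz0 (Matrix.mulVec_zero _)
    have hup : u ∉ openOrthant (d + 1) := by
      intro hup
      obtain ⟨v, hv, hv'⟩ := mem_closure_iff.1 hzc _
        ((hN j).isOpen_image (isOpen_openOrthant _)) (mem_image_of_mem _ hup)
      exact hv'.2 (mem_iUnion.2 ⟨j, image_mono (openOrthant_subset _) hv⟩)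
    have := mulVec_mem_attractorCone hN [j] (hb.mem_attractorCone hN hu hup hu0)
    rwa [wordMat_cons, wordMat_nil, mul_one] at this
  · exact hb.mem_attractorCone hN hzo hzp hz0

/-- Strip the common prefix. What remains is separated by two distinct first letters, or by the fact
that a hole avoids the images of the orthant under every letter. -/
theorem pairwise_disjoint_image_holeCone (hN : ∀ j, IsAdmissible (N j))
    (hd : Pairwise fun j k => Disjoint ((N j).mulVec '' openOrthant (d + 1))
      ((N k).mulVec '' openOrthant (d + 1))) :
    Pairwise fun u v => Disjoint ((wordMat N u).mulVec '' holeCone N)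
      ((wordMat N v).mulVec '' holeCone N) := by
  have hcons : ∀ j w, (wordMat N (j :: w)).mulVec '' holeCone N
      = (N j).mulVec '' ((wordMat N w).mulVec '' holeCone N) := fun j w => by
    rw [image_image]
    simp only [wordMat_cons, Matrix.mulVec_mulVec]
  have hpos : ∀ w, (wordMat N w).mulVec '' holeCone N ⊆ openOrthant (d + 1) := fun w =>
    image_subset_iff.2 fun y hy => (isAdmissible_wordMat hN w).mulVec_pos hy.1
  have hnil : ∀ j w, Disjoint (holeCone N) ((wordMat N (j :: w)).mulVec '' holeCone N) := by
    intro j w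
    rw [hcons]
    refine disjoint_left.2 fun y hy hy' => hy.2 (mem_iUnion.2 ⟨j, ?_⟩)
    exact image_mono ((hpos w).trans (openOrthant_subset _)) hy'
  have hone : (wordMat N []).mulVec '' holeCone N = holeCone N := by simp [wordMat_nil]
  intro u
  induction u with
  | nil =>
    intro v hv
    cases v with
    | nil => exact absurd rfl hv
    | cons k v => show Disjoint _ _; rw [hone]; exact hnil k v
  | cons j u ih =>
    intro v hv
    cases v with
    | nil => show Disjoint _ _; rw [hone]; exact (hnil j u).symm
    | cons k v =>
      show Disjoint _ _
      rw [hcons, hcons]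
      rcases eq_or_ne j k with rfl | hjk
      · exact (disjoint_image_iff (hN j).mulVec_injective).2 (ih fun h => hv (by rw [h]))
      · exact (hd hjk).mono (image_mono (hpos u)) (image_mono (hpos v))

/-! ### Volumes of truncated cones -/

/-- The sum of the entries of a matrix. -/
def entrySum (A : Matrix (Fin (d + 1)) (Fin (d + 1)) ℝ) : ℝ := ∑ i, ∑ j, A i j

theorem IsAdmissible.entrySum_pos {A : Matrix (Fin (d + 1)) (Fin (d + 1)) ℝ}
    (hA : IsAdmissible A) : 0 < entrySum A := by
  have h1 := sum_pos_of_mem_orthant (hA.mulVec_mem (y := fun _ => 1) fun _ => zero_le_one)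
    (hA.mulVec_ne_zero (Function.ne_iff.2 ⟨0, by simp⟩))
  simpa [Matrix.mulVec, dotProduct, entrySum] using h1

theorem sum_mulVec_le {A : Matrix (Fin (d + 1)) (Fin (d + 1)) ℝ}
    (hA : IsAdmissible A) {y : Fin (d + 1) → ℝ} (hy : y ∈ orthant (d + 1)) :
    ∑ i, A.mulVec y i ≤ entrySum A * ∑ i, y i := by
  simp only [Matrix.mulVec, dotProduct, entrySum, Finset.sum_mul]
  refine Finset.sum_le_sum fun i _ => Finset.sum_le_sum fun j _ => ?_
  exact mul_le_mul_of_nonneg_left (Finset.single_le_sum (fun k _ => hy k) (Finset.mem_univ j))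
    (hA.1 i j)

theorem entrySum_mul_le {A B : Matrix (Fin (d + 1)) (Fin (d + 1)) ℝ}
    (hA : IsAdmissible A) (hB : IsAdmissible B) :
    entrySum (A * B) ≤ entrySum A * entrySum B := by
  have h : ∀ M : Matrix (Fin (d + 1)) (Fin (d + 1)) ℝ,
      entrySum M = ∑ i, M.mulVec (fun _ => 1) i := fun M => by
    simp [Matrix.mulVec, dotProduct, entrySum]
  rw [h (A * B), h B, ← Matrix.mulVec_mulVec]
  exact sum_mulVec_le hA (hB.mulVec_mem fun _ => zero_le_one)

/-- The part of a set of vectors with coordinate sum at most `1`. -/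
def truncate (s : Set (Fin (d + 1) → ℝ)) : Set (Fin (d + 1) → ℝ) := {y ∈ s | ∑ i, y i ≤ 1}

/-- The matrix multiplies the coordinate sum by at most its entry sum, so shrinking the cone by that
factor keeps its image below height one. Shrinking costs the power `d + 1`; the matrix itself
preserves volume. -/
theorem volume_truncate_image_ge (hN : ∀ j, IsAdmissible (N j)) (w : List (Fin m)) :
    ENNReal.ofReal ((entrySum (wordMat N w))⁻¹ ^ (d + 1)) * volume (truncate (holeCone N)) ≤
      volume (truncate ((wordMat N w).mulVec '' holeCone N)) := by
  have hw := isAdmissible_wordMat hN w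
  have hpos := hw.entrySum_pos
  set t := (entrySum (wordMat N w))⁻¹ with ht
  have ht0 : 0 < t := inv_pos.2 hpos
  have hsub : (wordMat N w).mulVec '' (t • truncate (holeCone N)) ⊆
      truncate ((wordMat N w).mulVec '' holeCone N) := by
    rintro _ ⟨_, ⟨y, hy, rfl⟩, rfl⟩
    have hy' := smul_mem_holeCone ht0 hy.1
    refine ⟨mem_image_of_mem _ hy', ?_⟩
    refine (sum_mulVec_le hw fun i => (hy'.1 i).le).trans ?_
    simp only [Pi.smul_apply, smul_eq_mul]
    rw [← Finset.mul_sum, ← mul_assoc, ht, mul_inv_cancel₀ hpos.ne', one_mul]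
    exact hy.2
  refine le_trans (le_of_eq ?_) (measure_mono hsub)
  have h1 := Measure.addHaar_image_linearMap (volume : Measure (Fin (d + 1) → ℝ))
    (Matrix.toLin' (wordMat N w)) (t • truncate (holeCone N))
  rw [LinearMap.det_toLin', hw.abs_det, ENNReal.ofReal_one, one_mul, Measure.addHaar_smul] at h1
  have h2 : (⇑(Matrix.toLin' (wordMat N w))) = (wordMat N w).mulVec := rfl
  rw [h2] at h1
  rw [h1, Module.finrank_fin_fun, abs_of_nonneg (by positivity)]

/-- The projection which forgets the first coordinate. -/
def dropFirst (x : EuclideanSpace ℝ (Fin (d + 1))) : Fin d → ℝ := fun i => x i.succ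

/-- Coordinate projections are 1-Lipschitz, hence do not increase Hausdorff measure. This one-sided
comparison suffices for the lower bounds on `vol`. -/
theorem volume_dropFirst_image_le (U : Set (EuclideanSpace ℝ (Fin (d + 1)))) :
    volume (dropFirst '' U) ≤ vol d U := by
  set π : EuclideanSpace ℝ (Fin (d + 1)) → EuclideanSpace ℝ (Fin d) :=
    fun x => WithLp.toLp 2 (dropFirst x) with hπ
  have hlip : LipschitzWith 1 π := by
    refine LipschitzWith.of_dist_le_mul fun x y => ?_
    rw [NNReal.coe_one, one_mul, EuclideanSpace.dist_eq, EuclideanSpace.dist_eq]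
    refine Real.sqrt_le_sqrt ?_
    rw [Fin.sum_univ_succ (n := d)]
    exact le_add_of_nonneg_left (sq_nonneg _)
  have h1 : volume (π '' U) ≤ vol d U := by
    rw [← EuclideanSpace.euclideanHausdorffMeasure_eq_volume, vol,
      Measure.euclideanHausdorffMeasure_def, Measure.euclideanHausdorffMeasure_def,
      Measure.smul_apply, Measure.smul_apply]
    have h2 := hlip.hausdorffMeasure_image_le (Nat.cast_nonneg d) U
    rw [ENNReal.coe_one, ENNReal.one_rpow, one_mul] at h2
    gcongr
  refine le_trans (le_of_eq ?_) h1
  rw [← (PiLp.volume_preserving_toLp (Fin d)).measure_preimage_emb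
    (MeasurableEquiv.toLp 2 (Fin d → ℝ)).measurableEmbedding]
  congr 1
  ext z
  simp [hπ]

/-- A shear of determinant one makes the coordinate sum `s` the first coordinate. The slice at
height `s ≤ 1` then lies in `s • V`, of volume at most that of `V`, and Fubini applies. -/
theorem volume_cone_le {C : Set (Fin (d + 1) → ℝ)} {V : Set (Fin d → ℝ)}
    (hC : ∀ y ∈ C, 0 < ∑ i, y i ∧ ∑ i, y i ≤ 1 ∧ (fun i : Fin d => (∑ k, y k)⁻¹ * y i.succ) ∈ V) :
    volume C ≤ volume V := by
  set M : Matrix (Fin (d + 1)) (Fin (d + 1)) ℝ :=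
    fun i j => if i = 0 then 1 else if i = j then 1 else 0 with hM
  have hdet : M.det = 1 := by
    rw [Matrix.det_of_isUpperTriangular]
    · refine Finset.prod_eq_one fun i _ => ?_
      simp [hM]
    · intro i j hij
      have hij' : j < i := hij
      have h0 : i ≠ 0 := fun h => by simp [h] at hij'
      simp [hM, h0, hij'.ne']
  have hM0 : ∀ y, M.mulVec y 0 = ∑ i, y i := fun y => by simp [hM, Matrix.mulVec, dotProduct]
  have hMs : ∀ y (i : Fin d), M.mulVec y i.succ = y i.succ := fun y i => by
    simp [hM, Matrix.mulVec, dotProduct]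
  have himg : volume (M.mulVec '' C) = volume C := by
    have h1 := Measure.addHaar_image_linearMap (volume : Measure (Fin (d + 1) → ℝ))
      (Matrix.toLin' M) C
    rw [LinearMap.det_toLin', hdet, abs_one, ENNReal.ofReal_one, one_mul] at h1
    exact h1
  set V' := toMeasurable volume V
  set D : Set (ℝ × (Fin d → ℝ)) := {p | p.1 ∈ Ioc (0 : ℝ) 1 ∧ p.1⁻¹ • p.2 ∈ V'} with hD
  have hDm : MeasurableSet D := by
    refine (measurableSet_Ioc.preimage measurable_fst).inter
      ((measurableSet_toMeasurable volume V).preimage ?_)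
    fun_prop
  have hsub : M.mulVec '' C ⊆ (MeasurableEquiv.piFinSuccAbove (fun _ => ℝ) 0) ⁻¹' D := by
    rintro _ ⟨y, hy, rfl⟩
    obtain ⟨h1, h2, h3⟩ := hC y hy
    refine ⟨?_, subset_toMeasurable _ _ ?_⟩
    · show M.mulVec y 0 ∈ _
      rw [hM0]; exact ⟨h1, h2⟩
    · convert h3 using 1
      ext i
      show (M.mulVec y 0)⁻¹ * M.mulVec y i.succ = _
      rw [hM0, hMs]
  rw [← himg, ← measure_toMeasurable V]
  refine (measure_mono hsub).trans ?_
  rw [(volume_preserving_piFinSuccAbove (fun _ : Fin (d + 1) => ℝ) 0).measure_preimage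
    hDm.nullMeasurableSet, Measure.volume_eq_prod, Measure.prod_apply hDm]
  calc ∫⁻ s : ℝ, volume (Prod.mk s ⁻¹' D)
      ≤ ∫⁻ s : ℝ, (Ioc (0 : ℝ) 1).indicator (fun _ => volume V') s := by
        refine lintegral_mono fun s => ?_
        by_cases hs : s ∈ Ioc (0 : ℝ) 1
        · rw [indicator_of_mem hs]
          have h4 : Prod.mk s ⁻¹' D ⊆ s • V' := by
            intro z hz
            exact ⟨s⁻¹ • z, hz.2, by simp [smul_smul, hs.1.ne']⟩
          refine (measure_mono h4).trans ?_
          rw [Measure.addHaar_smul, Module.finrank_fin_fun, abs_of_nonneg (pow_nonneg hs.1.le _)]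
          refine mul_le_of_le_one_left' ?_
          rw [ENNReal.ofReal_le_one]
          exact pow_le_one₀ hs.1.le hs.2
        · have h4 : Prod.mk s ⁻¹' D = ∅ := by
            ext z
            simp only [mem_preimage, hD, mem_ofPred_eq, mem_empty_iff_false, iff_false]
            exact fun h => hs h.1
          rw [h4, measure_empty]
          exact zero_le
    _ = volume V' := by
        rw [lintegral_indicator measurableSet_Ioc, setLIntegral_const, Real.volume_Ioc]
        simp

theorem volume_cone_le_vol {C : Set (Fin (d + 1) → ℝ)}
    {U : Set (EuclideanSpace ℝ (Fin (d + 1)))}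
    (hC : ∀ y ∈ C, 0 < ∑ i, y i ∧ ∑ i, y i ≤ 1 ∧
      (WithLp.toLp 2 ((∑ k, y k)⁻¹ • y) : EuclideanSpace ℝ (Fin (d + 1))) ∈ U) :
    volume C ≤ vol d U := by
  refine le_trans (volume_cone_le fun y hy => ?_) (volume_dropFirst_image_le U)
  obtain ⟨h1, h2, h3⟩ := hC y hy
  exact ⟨h1, h2, _, h3, rfl⟩

theorem volume_truncate_pos {s : Set (Fin (d + 1) → ℝ)} (hs : IsOpen s) (hne : s.Nonempty)
    (hsmul : ∀ t : ℝ, 0 < t → ∀ y ∈ s, t • y ∈ s) : 0 < volume (truncate s) := by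
  have hsum : Continuous fun y : Fin (d + 1) → ℝ => ∑ i, y i := by fun_prop
  have hopen : IsOpen {y ∈ s | ∑ i, y i < 1} := hs.inter (isOpen_lt hsum continuous_const)
  obtain ⟨y, hy⟩ := hne
  have hne' : {y ∈ s | ∑ i, y i < 1}.Nonempty := by
    set t := (1 + |∑ i, y i|)⁻¹ with ht
    have hpos : 0 < 1 + |∑ i, y i| := by positivity
    refine ⟨t • y, hsmul t (inv_pos.2 hpos) y hy, ?_⟩
    simp only [Pi.smul_apply, smul_eq_mul]
    rw [← Finset.mul_sum, ht, inv_mul_eq_div, div_lt_one hpos]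
    linarith [le_abs_self (∑ i, y i)]
  exact (hopen.measure_pos volume hne').trans_le (measure_mono fun z hz => ⟨hz.1, hz.2.le⟩)

/-! ### Consequences of the hypotheses on the holes -/

/-- An uncovered boundary point would lie in a main hole, which is open in the hyperplane yet
contained in `Δ`. Moving slightly so that a vanishing coordinate becomes negative leaves `Δ` but not
the hole. -/
theorem coversBoundary_of_isInteriorOfSimplex (hN : ∀ j, IsAdmissible (N j)) (hd : 1 ≤ d)
    (hholes : ∀ H, IsMainHole N H → IsInteriorOfSimplex H) : CoversBoundary N := by
  intro y hy hyo hy0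
  by_contra hcon
  have hpos := sum_pos_of_mem_orthant hy hy0
  set x : EuclideanSpace ℝ (Fin (d + 1)) := WithLp.toLp 2 ((∑ i, y i)⁻¹ • y) with hx
  have hxs : x ∈ simplex d := by
    refine ⟨fun i => mul_nonneg (inv_nonneg.2 hpos.le) (hy i), ?_⟩
    simp only [hx, Pi.smul_apply, smul_eq_mul]
    rw [← Finset.mul_sum, inv_mul_cancel₀ hpos.ne']
  have hxA : x ∈ simplex d \ ⋃ j, proj (N j) '' simplex d := by
    refine ⟨hxs, fun h => hcon ?_⟩
    obtain ⟨j, hj⟩ := mem_iUnion.1 h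
    rw [mem_proj_image_iff (hN j) hxs.2] at hj
    obtain ⟨z, hz, hzx⟩ := hj
    refine ⟨j, (∑ i, y i) • z, fun i => mul_nonneg hpos.le (hz i), ?_⟩
    rw [Matrix.mulVec_smul, hzx, hx]
    simp [smul_smul, hpos.ne']
  obtain ⟨v, -, -, hv⟩ := hholes _ ⟨x, hxA, rfl⟩
  have hxH := mem_connectedComponentIn hxA
  have hHs : connectedComponentIn (simplex d \ ⋃ j, proj (N j) '' simplex d) x ⊆ simplex d :=
    (connectedComponentIn_subset _ _).trans sdiff_subset
  rw [hv] at hxH hHs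
  obtain ⟨⟨x', hx'h⟩, hx'i, hx'x⟩ := hxH
  obtain rfl : x' = x := hx'x
  obtain ⟨O, hO, hOi⟩ := isOpen_induced_iff.1
    (isOpen_interior (s := (Subtype.val ⁻¹' convexHull ℝ (range v) : Set (hyperplane d))))
  obtain ⟨i, hi⟩ : ∃ i, x i = 0 := by
    simp only [openOrthant, mem_ofPred_eq, not_forall, not_lt] at hyo
    obtain ⟨i, hi⟩ := hyo
    exact ⟨i, by simp [hx, le_antisymm hi (hy i)]⟩
  obtain ⟨k, hk⟩ : ∃ k : Fin (d + 1), k ≠ i := by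
    have : Nontrivial (Fin (d + 1)) := Fin.nontrivial_iff_two_le.2 (by omega)
    exact exists_ne i
  set c : ℝ → EuclideanSpace ℝ (Fin (d + 1)) := fun t =>
    x + t • (EuclideanSpace.single k (1 : ℝ) - EuclideanSpace.single i 1) with hc
  have hcc : Continuous c := by fun_prop
  have hc0 : c 0 ∈ O := by
    rw [← hOi] at hx'i
    simpa [hc] using hx'i
  have hev : ∀ᶠ t in 𝓝[>] (0 : ℝ), c t ∈ O :=
    (hcc.continuousAt.eventually (hO.mem_nhds hc0)).filter_mono nhdsWithin_le_nhds
  obtain ⟨t, htO, ht⟩ := (hev.and self_mem_nhdsWithin).exists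
  have hch : c t ∈ hyperplane d := by
    have h1 : ∑ j, x j = 1 := hxs.2
    simp [hyperplane, hc, Finset.sum_add_distrib, h1, ← Finset.mul_sum, Finset.sum_sub_distrib]
  have hmem : c t ∈ simplex d := by
    refine hHs ⟨⟨c t, hch⟩, ?_, rfl⟩
    rw [← hOi]
    exact htO
  have h2 := hmem.1 i
  have h3 : c t i = -t := by simp [hc, hi, hk.symm]
  rw [h3] at h2
  have : (0 : ℝ) < t := ht
  linarith

theorem disjoint_image_openOrthant (hN : ∀ j, IsAdmissible (N j))
    (hdisj : Pairwise fun j k => Disjoint (relInterior (proj (N j) '' simplex d))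
      (relInterior (proj (N k) '' simplex d))) :
    Pairwise fun j k => Disjoint ((N j).mulVec '' openOrthant (d + 1))
      ((N k).mulVec '' openOrthant (d + 1)) := by
  intro j k hjk
  rw [disjoint_left]
  intro y hyj hyk
  have hypos : y ∈ openOrthant (d + 1) := by
    obtain ⟨z, hz, rfl⟩ := hyj; exact (hN j).mulVec_pos hz
  have hpos : 0 < ∑ i, y i := Finset.sum_pos (fun i _ => hypos i) Finset.univ_nonempty
  have hsum : ∑ i, ((∑ i, y i)⁻¹ • y) i = 1 := by
    simp only [Pi.smul_apply, smul_eq_mul]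
    rw [← Finset.mul_sum, inv_mul_cancel₀ hpos.ne']
  have key : ∀ l, y ∈ (N l).mulVec '' openOrthant (d + 1) →
      (WithLp.toLp 2 ((∑ i, y i)⁻¹ • y) : EuclideanSpace ℝ (Fin (d + 1))) ∈
        relInterior (proj (N l) '' simplex d) := by
    rintro l ⟨z, hz, hzy⟩
    refine ⟨⟨_, hsum⟩, ?_, rfl⟩
    rw [mem_interior]
    refine ⟨(fun p : hyperplane d => p.1.ofLp) ⁻¹' ((N l).mulVec '' openOrthant (d + 1)), ?_,
      ((hN l).isOpen_image (isOpen_openOrthant _)).preimage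
        ((PiLp.continuous_ofLp 2 _).comp continuous_subtype_val), ?_⟩
    · intro p hp
      exact (mem_proj_image_iff (hN l) p.2).2 (image_mono (openOrthant_subset _) hp)
    · refine ⟨(∑ i, y i)⁻¹ • z, fun i => mul_pos (inv_pos.2 hpos) (hz i), ?_⟩
      rw [Matrix.mulVec_smul, hzy]
  exact disjoint_left.1 (hdisj hjk) (key j hyj) (key k hyk)

/-- Without holes the images cover the orthant at every level, so the attractor would be all of `Δ`,
which has positive volume. -/
theorem holeCone_nonempty (hN : ∀ j, IsAdmissible (N j)) (hb : CoversBoundary N)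
    (hvol : vol d (attractor N) = 0) : (holeCone N).Nonempty := by
  by_contra hcon
  rw [not_nonempty_iff_eq_empty] at hcon
  have hcov : ∀ y ∈ orthant (d + 1), y ≠ 0 → ∃ j, y ∈ (N j).mulVec '' orthant (d + 1) := by
    intro y hy hy0
    by_cases hyo : y ∈ openOrthant (d + 1)
    · by_contra h
      have : y ∈ holeCone N := ⟨hyo, by simpa using h⟩
      rw [hcon] at this
      exact this
    · exact hb y hy hyo hy0
  have hcone : ∀ y ∈ orthant (d + 1), y ≠ 0 → y ∈ attractorCone N := by
    intro y hy hy0 n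
    induction n generalizing y with
    | zero => exact ⟨[], rfl, y, hy, by rw [wordMat_nil, Matrix.one_mulVec]⟩
    | succ n ih =>
      obtain ⟨j, z, hz, rfl⟩ := hcov y hy hy0
      obtain ⟨w, hw, u, hu, rfl⟩ := ih z hz (by rintro rfl; exact hy0 (Matrix.mulVec_zero _))
      exact ⟨j :: w, by simp [hw], u, hu, by rw [wordMat_cons, ← Matrix.mulVec_mulVec]⟩
  have h1 : 0 < volume (truncate (openOrthant (d + 1))) :=
    volume_truncate_pos (isOpen_openOrthant _) ⟨fun _ => 1, fun _ => one_pos⟩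
      fun t ht y hy i => mul_pos ht (hy i)
  refine h1.ne' (le_antisymm (le_trans (volume_cone_le_vol fun y hy => ?_) hvol.le) zero_le)
  have hpos : 0 < ∑ i, y i := Finset.sum_pos (fun i _ => hy.1 i) Finset.univ_nonempty
  have hsum : ∑ i, ((∑ i, y i)⁻¹ • y) i = 1 := by
    simp only [Pi.smul_apply, smul_eq_mul]
    rw [← Finset.mul_sum, inv_mul_cancel₀ hpos.ne']
  refine ⟨hpos, hy.2, (mem_attractor_iff hN hsum).2 (hcone _ (fun i => ?_) ?_)⟩
  · exact mul_nonneg (inv_nonneg.2 hpos.le) (hy.1 i).le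
  · exact ne_zero_of_sum_eq_one hsum

/-- The standard basis vectors are boundary vectors. If one matrix covered all of them, its image
would be the whole orthant by linearity and leave no hole. -/
theorem nontrivial_of_coversBoundary (hd : 1 ≤ d) (hb : CoversBoundary N)
    (hne : (holeCone N).Nonempty) : Nontrivial (Fin m) := by
  have hdn : Nontrivial (Fin (d + 1)) := Fin.nontrivial_iff_two_le.2 (by omega)
  have he : ∀ k : Fin (d + 1), ∃ j, Pi.single k 1 ∈ (N j).mulVec '' orthant (d + 1) := by
    intro k
    refine hb _ (fun i => ?_) (fun h => ?_) (by simp)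
    · rw [Pi.single_apply]; split_ifs <;> norm_num
    · obtain ⟨i, hi⟩ := exists_ne k
      have := h i
      simp [hi] at this
  choose j z hz hzk using he
  obtain ⟨y, hy, hy'⟩ := hne
  by_contra hcon
  rw [not_nontrivial_iff_subsingleton] at hcon
  refine hy' (mem_iUnion.2 ⟨j 0, ∑ k, y k • z k, fun i => ?_, ?_⟩)
  · simp only [Finset.sum_apply, Pi.smul_apply, smul_eq_mul]
    exact Finset.sum_nonneg fun k _ => mul_nonneg (hy k).le (hz k i)
  · have h1 : ∀ k, (N (j 0)).mulVec (z k) = Pi.single k 1 := fun k => by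
      rw [Subsingleton.elim (j 0) (j k)]; exact hzk k
    rw [Matrix.mulVec_sum]
    simp only [Matrix.mulVec_smul, h1]
    ext i
    simp [Finset.sum_apply, Pi.single_apply]

/-! ### The packing bound on the number of words -/

theorem exists_card_le_entrySum (hN : ∀ j, IsAdmissible (N j))
    (hd : Pairwise fun j k => Disjoint ((N j).mulVec '' openOrthant (d + 1))
      ((N k).mulVec '' openOrthant (d + 1))) (hne : (holeCone N).Nonempty) :
    ∃ A : ℝ, ∀ (F : Finset (List (Fin m))) (T : ℝ), 0 < T →
      (∀ w ∈ F, entrySum (wordMat N w) ≤ T) → (F.card : ℝ) ≤ A * T ^ (d + 1) := by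
  set τ := volume (truncate (holeCone N)) with hτ
  set τ' := volume (truncate (openOrthant (d + 1)))
  have hτ0 : 0 < τ := volume_truncate_pos (isOpen_holeCone hN) hne
    fun t ht y hy => smul_mem_holeCone ht hy
  have hτ' : τ' ≠ ⊤ := by
    refine ne_top_of_le_ne_top (isCompact_Icc (a := (0 : Fin (d + 1) → ℝ)) (b := 1)).measure_ne_top
      (measure_mono fun y hy => ⟨fun i => (hy.1 i).le, fun i => ?_⟩)
    exact (Finset.single_le_sum (fun k _ => (hy.1 k).le) (Finset.mem_univ i)).trans hy.2
  have hτt : τ ≠ ⊤ := ne_top_of_le_ne_top hτ' (measure_mono fun y hy => ⟨hy.1.1, hy.2⟩)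
  have hτr : 0 < τ.toReal := ENNReal.toReal_pos hτ0.ne' hτt
  refine ⟨τ'.toReal / τ.toReal, fun F T hT hF => ?_⟩
  have hmeas : ∀ w, MeasurableSet (truncate ((wordMat N w).mulVec '' holeCone N)) := fun w =>
    ((isAdmissible_wordMat hN w).isOpen_image (isOpen_holeCone hN)).measurableSet.inter
      (measurableSet_le (f := fun y : Fin (d + 1) → ℝ => ∑ i, y i) (by fun_prop)
        measurable_const)
  have h1 : ∑ w ∈ F, volume (truncate ((wordMat N w).mulVec '' holeCone N)) ≤ τ' := by
    rw [← measure_biUnion_finset _ fun w _ => hmeas w]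
    · refine measure_mono (iUnion₂_subset fun w _ => ?_)
      rintro _ ⟨⟨y, hy, rfl⟩, h⟩
      exact ⟨(isAdmissible_wordMat hN w).mulVec_pos hy.1, h⟩
    · intro u _ v _ huv
      exact (pairwise_disjoint_image_holeCone hN hd huv).mono (fun _ h => h.1) (fun _ h => h.1)
  have h2 : ∀ w ∈ F, ENNReal.ofReal (T⁻¹ ^ (d + 1)) * τ ≤
      volume (truncate ((wordMat N w).mulVec '' holeCone N)) := by
    intro w hw
    refine le_trans ?_ (volume_truncate_image_ge hN w)
    have := (isAdmissible_wordMat hN w).entrySum_pos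
    have := hF w hw
    gcongr
  have h3 : (F.card : ENNReal) * (ENNReal.ofReal (T⁻¹ ^ (d + 1)) * τ) ≤ τ' := by
    rw [← nsmul_eq_mul, ← Finset.sum_const]
    exact (Finset.sum_le_sum h2).trans h1
  have h4 := ENNReal.toReal_mono hτ' h3
  rw [ENNReal.toReal_mul, ENNReal.toReal_mul, ENNReal.toReal_ofReal (by positivity),
    ENNReal.toReal_natCast] at h4
  have hTp : 0 < T ^ (d + 1) := by positivity
  rw [div_mul_eq_mul_div, le_div_iff₀ hτr]
  calc (F.card : ℝ) * τ.toReal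
      = F.card * (T⁻¹ ^ (d + 1) * τ.toReal) * T ^ (d + 1) := by
        rw [inv_pow]; field_simp
    _ ≤ τ'.toReal * T ^ (d + 1) := mul_le_mul_of_nonneg_right h4 hTp.le

theorem finite_entrySum_le (hN : ∀ j, IsAdmissible (N j))
    (hd : Pairwise fun j k => Disjoint ((N j).mulVec '' openOrthant (d + 1))
      ((N k).mulVec '' openOrthant (d + 1))) (hne : (holeCone N).Nonempty) (T : ℝ) :
    {w : List (Fin m) | entrySum (wordMat N w) ≤ T}.Finite := by
  obtain ⟨A, hA⟩ := exists_card_le_entrySum hN hd hne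
  by_contra hinf
  obtain ⟨n, hn⟩ := exists_nat_gt (A * (max T 1) ^ (d + 1))
  obtain ⟨F, hF, hFn⟩ := Set.Infinite.exists_subset_card_eq hinf n
  have := hA F (max T 1) (by positivity) fun w hw => le_trans (hF hw) (le_max_left _ _)
  rw [hFn] at this
  linarith

/-! ### Volume of neighbourhoods of the attractor -/

/-- The union of the images of the main holes under the projective map of a word. -/
def holeImage (N : Fin m → Matrix (Fin (d + 1)) (Fin (d + 1)) ℝ) (w : List (Fin m)) :
    Set (EuclideanSpace ℝ (Fin (d + 1))) :=
  {x | ∑ i, x i = 1 ∧ x.ofLp ∈ (wordMat N w).mulVec '' holeCone N}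

theorem measurableSet_holeImage (hN : ∀ j, IsAdmissible (N j)) (w : List (Fin m)) :
    MeasurableSet (holeImage N w) :=
  (measurableSet_eq_fun (by fun_prop) measurable_const).inter
    (((isAdmissible_wordMat hN w).isOpen_image (isOpen_holeCone hN)).preimage
      (PiLp.continuous_ofLp 2 _)).measurableSet

theorem holeImage_subset_simplex (hN : ∀ j, IsAdmissible (N j)) (w : List (Fin m)) :
    holeImage N w ⊆ simplex d := by
  rintro x ⟨hx, y, hy, hyx⟩
  refine ⟨fun i => ?_, hx⟩
  have := ((isAdmissible_wordMat hN w).mulVec_pos hy.1 i).le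
  rwa [hyx] at this

/-- A connected set cannot leave a hole image without crossing its frontier, which belongs to the
attractor. -/
theorem subset_holeImage (hN : ∀ j, IsAdmissible (N j)) (hb : CoversBoundary N)
    (w : List (Fin m)) {s : Set (EuclideanSpace ℝ (Fin (d + 1)))} (hs : IsPreconnected s)
    (hsh : s ⊆ hyperplane d) (hne : (s ∩ holeImage N w).Nonempty)
    (hdis : Disjoint s (attractor N)) : s ⊆ holeImage N w := by
  set B := (wordMat N w).mulVec '' holeCone N with hB
  have hs' : IsPreconnected (WithLp.ofLp '' s) :=
    hs.image _ (PiLp.continuous_ofLp 2 _).continuousOn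
  have hBo : IsOpen B := (isAdmissible_wordMat hN w).isOpen_image (isOpen_holeCone hN)
  obtain ⟨y, hys, hyw⟩ := hne
  have hsub : WithLp.ofLp '' s ⊆ B := by
    refine hs'.subset_left_of_subset_union hBo isClosed_closure.isOpen_compl
      (disjoint_compl_right_iff_subset.2 subset_closure) ?_ ⟨_, mem_image_of_mem _ hys, hyw.2⟩
    rintro _ ⟨z, hzs, rfl⟩
    by_contra hz
    rw [mem_union, mem_compl_iff, not_or, not_not] at hz
    refine disjoint_left.1 hdis hzs ((mem_attractor_iff hN (hsh hzs)).2 ?_)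
    refine frontier_image_holeCone_subset hN hb w (ne_zero_of_sum_eq_one (hsh hzs)) ?_
    rw [hBo.frontier_eq]
    exact ⟨hz.2, hz.1⟩
  exact fun x hx => ⟨hsh hx, hsub (mem_image_of_mem _ hx)⟩

theorem mem_attractor_of_eq_zero (hN : ∀ j, IsAdmissible (N j)) (hb : CoversBoundary N)
    {x : EuclideanSpace ℝ (Fin (d + 1))} (hx : x ∈ simplex d) {i : Fin (d + 1)} (hi : x i = 0) :
    x ∈ attractor N :=
  (mem_attractor_iff hN hx.2).2 <| hb.mem_attractorCone hN hx.1 (fun h => (h i).ne' hi)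
    (ne_zero_of_sum_eq_one hx.2)

theorem single_mem_attractor (hN : ∀ j, IsAdmissible (N j)) (hd : 1 ≤ d) (hb : CoversBoundary N) :
    EuclideanSpace.single 0 1 ∈ attractor N := by
  refine mem_attractor_of_eq_zero hN hb (i := Fin.last d) ⟨fun i => ?_, ?_⟩ ?_
  · rw [PiLp.single_apply]; split_ifs <;> norm_num
  · simp
  · have : Fin.last d ≠ 0 := by
      intro h; have := congrArg Fin.val h; simp at this; omega
    simp [this]

theorem convex_hyperplane : Convex ℝ (hyperplane d) := by
  intro x hx y hy a b _ _ hab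
  have hx' : ∑ i, x i = 1 := hx
  have hy' : ∑ i, y i = 1 := hy
  simp [hyperplane, Finset.sum_add_distrib, ← Finset.mul_sum, hx', hy', hab]

theorem norm_le_sum_abs {n : ℕ} (x : EuclideanSpace ℝ (Fin n)) : ‖x‖ ≤ ∑ i, |x i| := by
  rw [EuclideanSpace.norm_eq]
  refine Real.sqrt_le_iff.2 ⟨Finset.sum_nonneg fun i _ => abs_nonneg _, ?_⟩
  simp only [Real.norm_eq_abs]
  exact Finset.sum_sq_le_sq_sum_of_nonneg fun i _ => abs_nonneg _

theorem vol_ball_inter_hyperplane_ge {z : EuclideanSpace ℝ (Fin (d + 1))} (hz : z ∈ hyperplane d)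
    {r : ℝ} (hr : 0 < r) :
    ENNReal.ofReal ((r / (d + 1)) ^ d) ≤ vol d (Metric.ball z r ∩ hyperplane d) := by
  -- Over a cube of half-side `δ` the first coordinate varies by at most `d * δ`, so the `ℓ¹`
  -- displacement is at most `2 * d * δ < r`.
  set δ := r / (2 * (d + 1)) with hδ
  have hδ0 : 0 < δ := by positivity
  have h1 : volume (Metric.ball (dropFirst z) δ) = ENNReal.ofReal ((r / (d + 1)) ^ d) := by
    rw [Real.volume_pi_ball _ hδ0, Fintype.card_fin]
    congr 2
    rw [hδ]; field_simp
  rw [← h1]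
  refine le_trans (measure_mono ?_) (volume_dropFirst_image_le _)
  intro u hu
  have hu' : ∀ i : Fin d, |u i - z i.succ| ≤ δ := fun i => by
    have := (dist_pi_lt_iff hδ0).1 hu i
    rw [Real.dist_eq] at this
    exact this.le
  have hz' : z 0 + ∑ i : Fin d, z i.succ = 1 := by
    rw [← Fin.sum_univ_succ (f := fun i => z i)]; exact hz
  set q : EuclideanSpace ℝ (Fin (d + 1)) :=
    WithLp.toLp 2 (Fin.cons (1 - ∑ i, u i) u) with hq
  have hq0 : q 0 = 1 - ∑ i, u i := rfl
  have hqs : ∀ i : Fin d, q i.succ = u i := fun i => rfl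
  refine ⟨q, ⟨?_, ?_⟩, rfl⟩
  · rw [Metric.mem_ball, dist_eq_norm]
    refine (norm_le_sum_abs _).trans_lt ?_
    rw [Fin.sum_univ_succ]
    simp only [PiLp.sub_apply, hq0, hqs]
    have h2 : ∑ i : Fin d, |u i - z i.succ| ≤ d * δ := by
      refine (Finset.sum_le_sum fun i _ => hu' i).trans ?_
      simp
    have h3 : |1 - ∑ i, u i - z 0| ≤ ∑ i : Fin d, |u i - z i.succ| := by
      have : 1 - ∑ i, u i - z 0 = -∑ i : Fin d, (u i - z i.succ) := by
        rw [Finset.sum_sub_distrib]; linarith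
      rw [this, abs_neg]
      exact Finset.abs_sum_le_sum_abs _ _
    have h4 : 2 * (d * δ) < r := by
      rw [hδ]
      have : (0 : ℝ) < d + 1 := by positivity
      field_simp
      linarith
    linarith
  · show ∑ i, q i = 1
    rw [Fin.sum_univ_succ]
    simp [hq0, hqs]

theorem vol_nhd_inter_holeImage_ge (hN : ∀ j, IsAdmissible (N j)) (hd : 1 ≤ d)
    (hb : CoversBoundary N) (w : List (Fin m)) {ε : ℝ} (hε : 0 < ε) :
    min (ENNReal.ofReal ((entrySum (wordMat N w))⁻¹ ^ (d + 1)) * volume (truncate (holeCone N)))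
      (ENNReal.ofReal ((ε / 2 / (d + 1)) ^ d)) ≤
      vol d (nhd (attractor N) ε ∩ holeImage N w) := by
  have hw := isAdmissible_wordMat hN w
  by_cases hsub : holeImage N w ⊆ nhd (attractor N) ε
  · refine min_le_of_left_le ((volume_truncate_image_ge hN w).trans ?_)
    rw [inter_eq_right.2 hsub]
    refine volume_cone_le_vol ?_
    rintro _ ⟨⟨y, hy, rfl⟩, hle⟩
    have hyp := hw.mulVec_pos hy.1
    have hpos := Finset.sum_pos (fun i _ => hyp i) Finset.univ_nonempty
    refine ⟨hpos, hle, ?_, ?_⟩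
    · simp only [Pi.smul_apply, smul_eq_mul]
      rw [← Finset.mul_sum, inv_mul_cancel₀ hpos.ne']
    · exact ⟨_, smul_mem_holeCone (inv_pos.2 hpos) hy, Matrix.mulVec_smul _ _ _⟩
  · refine min_le_of_right_le ?_
    obtain ⟨x, hxw, hx⟩ := not_subset.1 hsub
    have hxs := holeImage_subset_simplex hN w hxw
    have hg := single_mem_attractor hN hd hb
    set g : EuclideanSpace ℝ (Fin (d + 1)) := EuclideanSpace.single 0 1
    have hgs := attractor_subset_simplex hN hg
    set φ : EuclideanSpace ℝ (Fin (d + 1)) → ℝ := fun q => Metric.infDist q (attractor N) with hφ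
    have hφc : Continuous φ := Metric.continuous_infDist_pt _
    have hφx : ε ≤ φ x := by
      refine (Metric.le_infDist ⟨g, hg⟩).2 fun y hy => ?_
      by_contra h
      exact hx ⟨hxs, y, hy, by rw [← dist_eq_norm]; linarith⟩
    have hφ0 : ∀ q ∈ attractor N, φ q = 0 := fun q hq => Metric.infDist_zero_of_mem hq
    set p : ℝ → EuclideanSpace ℝ (Fin (d + 1)) := fun t => AffineMap.lineMap x g t with hp
    have hpc : Continuous p := AffineMap.lineMap_continuous
    have hph : ∀ t ∈ Icc (0 : ℝ) 1, p t ∈ hyperplane d := fun t ht =>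
      convex_hyperplane.lineMap_mem hxs.2 hgs.2 ht
    have hp0 : p 0 = x := AffineMap.lineMap_apply_zero _ _
    have hp1 : p 1 = g := AffineMap.lineMap_apply_one _ _
    have hcomp : IsCompact {t ∈ Icc (0 : ℝ) 1 | φ (p t) ≤ ε / 2} :=
      isCompact_Icc.inter_right (isClosed_le (hφc.comp hpc) continuous_const)
    -- First time at which the segment from a deep point of the hole image to a vertex in the
    -- attractor comes within `ε / 2` of the attractor. Up to then it stays in the hole image, and
    -- the ball of radius `ε / 2` there misses the attractor.
    obtain ⟨t, ⟨ht, htφ⟩, hmin⟩ := hcomp.exists_isLeast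
      ⟨1, ⟨zero_le_one, le_rfl⟩, by rw [hp1, hφ0 g hg]; positivity⟩
    have hteq : φ (p t) = ε / 2 := by
      obtain ⟨t', ht', hφt'⟩ := intermediate_value_Icc' ht.1 (hφc.comp hpc).continuousOn
        (show ε / 2 ∈ Icc ((φ ∘ p) t) ((φ ∘ p) 0) from
          ⟨htφ, by simp only [Function.comp, hp0]; linarith⟩)
      have := hmin ⟨⟨ht'.1, ht'.2.trans ht.2⟩, le_of_eq hφt'⟩
      rwa [le_antisymm ht'.2 this] at hφt'
    have hseg : p '' Icc 0 t ⊆ holeImage N w := by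
      refine subset_holeImage hN hb w (isPreconnected_Icc.image _ hpc.continuousOn) ?_ ?_ ?_
      · rintro _ ⟨s, hs, rfl⟩
        exact hph s ⟨hs.1, hs.2.trans ht.2⟩
      · exact ⟨x, ⟨0, ⟨le_rfl, ht.1⟩, hp0⟩, hxw⟩
      · rw [disjoint_left]
        rintro _ ⟨s, hs, rfl⟩ hsG
        have hs0 := hφ0 _ hsG
        have := hmin ⟨⟨hs.1, hs.2.trans ht.2⟩, by rw [hs0]; positivity⟩
        rw [le_antisymm hs.2 this, hteq] at hs0
        linarith
    have hpt : p t ∈ holeImage N w := hseg ⟨t, ⟨ht.1, le_rfl⟩, rfl⟩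
    have hball : Metric.ball (p t) (ε / 2) ∩ hyperplane d ⊆ holeImage N w := by
      refine subset_holeImage hN hb w ((convex_ball _ _).inter convex_hyperplane).isPreconnected
        inter_subset_right ⟨p t, ⟨Metric.mem_ball_self (by positivity), hph t ht⟩, hpt⟩ ?_
      rw [disjoint_left]
      rintro q ⟨hq, -⟩ hqG
      have h1 : φ (p t) ≤ dist (p t) q := Metric.infDist_le_dist_of_mem hqG
      rw [Metric.mem_ball, dist_comm] at hq
      linarith
    refine (vol_ball_inter_hyperplane_ge (hph t ht) (half_pos hε)).trans (measure_mono ?_)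
    intro q hq
    refine ⟨⟨holeImage_subset_simplex hN w (hball hq), ?_⟩, hball hq⟩
    have h1 : φ q < ε := by
      have h2 : φ q ≤ φ (p t) + dist q (p t) := Metric.infDist_le_infDist_add_dist
      have h3 := Metric.mem_ball.1 hq.1
      linarith
    obtain ⟨y, hy, hqy⟩ := (Metric.infDist_lt_iff ⟨g, hg⟩).1 h1
    exact ⟨y, hy, by rw [← dist_eq_norm]; exact hqy.le⟩

theorem vol_nhd_attractor_ge (hN : ∀ j, IsAdmissible (N j)) (hd : 1 ≤ d)
    (hb : CoversBoundary N)
    (hdis : Pairwise fun j k => Disjoint ((N j).mulVec '' openOrthant (d + 1))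
      ((N k).mulVec '' openOrthant (d + 1))) (hne : (holeCone N).Nonempty) :
    ∃ c : ℝ, 0 < c ∧ ∀ ε T : ℝ, 0 < ε → 0 < T → T⁻¹ ^ (d + 1) = ε ^ d →
      ENNReal.ofReal (c * ε ^ d * count (fun w => entrySum (wordMat N w)) T) ≤
        vol d (nhd (attractor N) ε) := by
  set τ := volume (truncate (holeCone N)) with hτ
  have hτ0 : 0 < τ := volume_truncate_pos (isOpen_holeCone hN) hne
    fun t ht y hy => smul_mem_holeCone ht hy
  obtain ⟨a, ha0, haτ⟩ : ∃ a : ℝ, 0 < a ∧ ENNReal.ofReal a ≤ τ := by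
    obtain ⟨a, -, h1, h2⟩ := ENNReal.lt_iff_exists_real_btwn.1 hτ0
    exact ⟨a, ENNReal.ofReal_pos.1 h1, h2.le⟩
  refine ⟨min a ((1 / 2 / (d + 1)) ^ d), by positivity, fun ε T hε hT hεT => ?_⟩
  set c := min a ((1 / 2 / ((d : ℝ) + 1)) ^ d)
  have hc : 0 < c := by positivity
  have hfin := finite_entrySum_le hN hdis hne T
  set F := hfin.toFinset with hF
  have h1 : ∀ w ∈ F, ENNReal.ofReal (c * ε ^ d) ≤ vol d (nhd (attractor N) ε ∩ holeImage N w) := by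
    intro w hw
    have hwT : entrySum (wordMat N w) ≤ T := by simpa [hF] using hw
    have hwp := (isAdmissible_wordMat hN w).entrySum_pos
    refine le_trans (le_min ?_ ?_) (vol_nhd_inter_holeImage_ge hN hd hb w hε)
    · rw [← hεT, mul_comm, ENNReal.ofReal_mul (by positivity)]
      have h2 : ENNReal.ofReal c ≤ τ := (ENNReal.ofReal_le_ofReal (min_le_left _ _)).trans haτ
      gcongr
    · refine ENNReal.ofReal_le_ofReal ?_
      calc c * ε ^ d ≤ (1 / 2 / ((d : ℝ) + 1)) ^ d * ε ^ d :=
            mul_le_mul_of_nonneg_right (min_le_right _ _) (by positivity)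
        _ = (ε / 2 / (d + 1)) ^ d := by rw [← mul_pow]; congr 1; ring
  have h2 : ∑ w ∈ F, vol d (nhd (attractor N) ε ∩ holeImage N w) ≤
      vol d (nhd (attractor N) ε) := by
    -- Passing to the restricted measure makes additivity need measurability of the hole images
    -- only.
    have h3 : ∀ w, vol d (nhd (attractor N) ε ∩ holeImage N w) =
        (vol d).restrict (nhd (attractor N) ε) (holeImage N w) := fun w => by
      rw [Measure.restrict_apply (measurableSet_holeImage hN w), inter_comm]
    simp only [h3]
    rw [← measure_biUnion_finset _ fun w _ => measurableSet_holeImage hN w]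
    · refine (measure_mono (subset_univ _)).trans ?_
      rw [Measure.restrict_apply_univ]
    · intro u _ v _ huv
      exact disjoint_left.2 fun x hx hx' =>
        disjoint_left.1 (pairwise_disjoint_image_holeCone hN hdis huv) hx.2 hx'.2
  refine le_trans ?_ ((Finset.sum_le_sum h1).trans h2)
  rw [Finset.sum_const, nsmul_eq_mul, ENNReal.ofReal_mul (by positivity), mul_comm,
    ENNReal.ofReal_natCast, count, ncard_eq_toFinset_card _ hfin]

/-- The facets of `Δ` lie in the attractor. Over a box with one side `ε / 2` and the others `1 / d`,
transferring the thin coordinate to the first one reaches a facet, with displacement at most `2 * (ε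
/ 2)`. -/
theorem vol_nhd_attractor_ge_linear (hN : ∀ j, IsAdmissible (N j)) (hd : 1 ≤ d)
    (hb : CoversBoundary N) {ε : ℝ} (hε : 0 < ε) (hε' : ε ≤ 1 / d) :
    ENNReal.ofReal ((1 / d) ^ (d - 1) / 2 * ε) ≤ vol d (nhd (attractor N) ε) := by
  have hd0 : (0 : ℝ) < d := by exact_mod_cast hd
  set k : Fin d := ⟨0, by omega⟩
  set b : Fin d → ℝ := Function.update (fun _ => 1 / (d : ℝ)) k (ε / 2) with hb'
  have hbk : b k = ε / 2 := by simp [hb']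
  have hbd : ∀ i, b i ≤ 1 / d := fun i => by
    rcases eq_or_ne i k with rfl | h
    · rw [hbk]; linarith
    · simp [hb', h]
  have hvol : volume (Icc 0 b) = ENNReal.ofReal ((1 / d) ^ (d - 1) / 2 * ε) := by
    rw [Real.volume_Icc_pi]
    simp only [Pi.zero_apply, sub_zero]
    rw [← ENNReal.ofReal_prod_of_nonneg]
    · congr 1
      rw [hb', Finset.prod_update_of_mem (Finset.mem_univ k), Finset.prod_const,
        Finset.card_sdiff_of_subset (Finset.subset_univ _)]
      simp
      ring
    · intro i _
      rcases eq_or_ne i k with rfl | h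
      · rw [hbk]; positivity
      · simp [hb', h]
  rw [← hvol]
  refine le_trans (measure_mono ?_) (volume_dropFirst_image_le _)
  rintro u ⟨hu0, hub⟩
  have husum : ∑ i, u i ≤ 1 := by
    refine (Finset.sum_le_sum fun i _ => (hub i).trans (hbd i)).trans ?_
    simp [hd0.ne']
  set x : EuclideanSpace ℝ (Fin (d + 1)) := WithLp.toLp 2 (Fin.cons (1 - ∑ i, u i) u) with hx
  have hx0 : x 0 = 1 - ∑ i, u i := rfl
  have hxs : ∀ i : Fin d, x i.succ = u i := fun i => rfl
  have hxmem : x ∈ simplex d := by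
    refine ⟨fun i => ?_, ?_⟩
    · refine Fin.cases ?_ (fun i => ?_) i
      · rw [hx0]; linarith
      · rw [hxs]; exact hu0 i
    · rw [Fin.sum_univ_succ]; simp [hx0, hxs]
  set e : EuclideanSpace ℝ (Fin (d + 1)) :=
    u k • (EuclideanSpace.single 0 1 - EuclideanSpace.single k.succ 1) with he
  have hesum : ∑ i, e i = 0 := by
    simp [he, ← Finset.mul_sum, Finset.sum_sub_distrib]
  refine ⟨x, ⟨hxmem, x + e, mem_attractor_of_eq_zero hN hb (i := k.succ) ⟨fun i => ?_, ?_⟩ ?_, ?_⟩,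
    rfl⟩
  · rcases eq_or_ne i k.succ with rfl | hi
    · simp [he, hxs]
    · have h1 : e i = u k * (if i = 0 then 1 else 0) := by
        simp [he, hi, PiLp.single_apply]
      rw [PiLp.add_apply, h1]
      have := hxmem.1 i
      have h2 : 0 ≤ u k := hu0 k
      split_ifs <;> simp <;> linarith
  · simp only [PiLp.add_apply]
    rw [Finset.sum_add_distrib, hesum, hxmem.2, add_zero]
  · simp [he, hxs]
  · rw [sub_add_cancel_left, norm_neg, he, norm_smul, Real.norm_of_nonneg (hu0 k)]
    have h1 : ‖(EuclideanSpace.single 0 1 - EuclideanSpace.single k.succ 1 :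
        EuclideanSpace ℝ (Fin (d + 1)))‖ ≤ 2 := by
      refine (norm_sub_le _ _).trans ?_
      simp
      norm_num
    have h2 := hub k
    rw [hbk] at h2
    have h3 : 0 ≤ u k := hu0 k
    nlinarith

/-! ### From volume bounds to the box dimension -/

/-- Dividing by `log ε < 0` reverses the volume bound into an upper bound for the liminf. An
exponent `z > d - s'` absorbs the constant `c` for small `ε`. -/
theorem le_upperBoxDim {S : Set (EuclideanSpace ℝ (Fin (d + 1)))} {s : ℝ}
    (h : ∀ s' < s, ∃ c : ℝ, 0 < c ∧
      ∀ᶠ ε : ℝ in 𝓝[>] 0, ENNReal.ofReal (c * ε ^ (d - s')) ≤ vol d (nhd S ε)) :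
    (s : EReal) ≤ upperBoxDim S := by
  have hlim : liminf (fun ε : ℝ => ENNReal.log (vol d (nhd S ε)) / ((Real.log ε : ℝ) : EReal))
      (𝓝[>] 0) ≤ ((d - s : ℝ) : EReal) := by
    refine EReal.le_of_forall_lt_iff_le.1 fun z hz => ?_
    have hz' : d - s < z := by exact_mod_cast hz
    obtain ⟨s', hs', hs's⟩ := exists_between (show d - z < s by linarith)
    obtain ⟨c, hc, hev⟩ := h s' hs's
    have hδ : 0 < z - (d - s') := by linarith
    have hsmall : ∀ᶠ ε : ℝ in 𝓝[>] 0, ε ^ (z - (d - s')) < c := by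
      have h1 : Tendsto (fun ε : ℝ => ε ^ (z - (d - s'))) (𝓝[>] 0) (𝓝 0) := by
        have h2 := (Real.continuousAt_rpow_const 0 (z - (d - s')) (Or.inr hδ.le)).tendsto
        rw [Real.zero_rpow hδ.ne'] at h2
        exact h2.mono_left nhdsWithin_le_nhds
      exact h1.eventually_lt_const hc
    have hlt1 : ∀ᶠ ε : ℝ in 𝓝[>] 0, ε < 1 :=
      (eventually_lt_nhds one_pos).filter_mono nhdsWithin_le_nhds
    refine liminf_le_of_frequently_le' (Eventually.frequently ?_)
    filter_upwards [hev, hsmall, hlt1, self_mem_nhdsWithin] with ε h1 h2 h3 h4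
    have hε : 0 < ε := h4
    have hlog : Real.log ε < 0 := Real.log_neg hε h3
    have h5 : ENNReal.ofReal (ε ^ z) ≤ vol d (nhd S ε) := by
      refine le_trans (ENNReal.ofReal_le_ofReal ?_) h1
      have : ε ^ z = ε ^ (z - (d - s')) * ε ^ (d - s') := by
        rw [← Real.rpow_add hε]; congr 1; ring
      rw [this]
      exact mul_le_mul_of_nonneg_right h2.le (by positivity)
    have h6 : ((z * Real.log ε : ℝ) : EReal) ≤ ENNReal.log (vol d (nhd S ε)) := by
      refine le_trans (le_of_eq ?_) (ENNReal.log_monotone h5)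
      rw [ENNReal.log_ofReal_of_pos (by positivity), Real.log_rpow hε]
    refine (EReal.div_le_div_right_of_nonpos (by exact_mod_cast hlog.le) h6).trans (le_of_eq ?_)
    rw [← EReal.coe_div, mul_div_cancel_right₀ _ hlog.ne]
  rw [upperBoxDim]
  have h1 := EReal.sub_le_sub (le_refl (d : EReal)) hlim
  refine le_trans (le_of_eq ?_) h1
  rw [show (d : EReal) = ((d : ℝ) : EReal) from rfl, ← EReal.coe_sub]
  congr 1
  ring

/-! ### Equivalence of norms on matrices -/

theorem exists_seminorm_le_sum_abs {n : ℕ} (ν : Seminorm ℝ (Matrix (Fin n) (Fin n) ℝ)) :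
    ∃ c : ℝ, 0 < c ∧ ∀ A, ν A ≤ c * ∑ i, ∑ j, |A i j| := by
  set b := ∑ i, ∑ j, ν (Matrix.single i j 1) with hb
  have hb0 : 0 ≤ b := Finset.sum_nonneg fun i _ => Finset.sum_nonneg fun j _ => apply_nonneg ν _
  refine ⟨b + 1, by positivity, fun A => ?_⟩
  have hle : ∀ i j, ν (Matrix.single i j 1) ≤ b := fun i j =>
    (Finset.single_le_sum (f := fun j => ν (Matrix.single i j 1))
      (fun k _ => apply_nonneg ν _) (Finset.mem_univ j)).trans
    (Finset.single_le_sum (f := fun i => ∑ j, ν (Matrix.single i j 1))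
      (fun k _ => Finset.sum_nonneg fun j _ => apply_nonneg ν _) (Finset.mem_univ i))
  have hsum : ∀ (f : Fin n → Matrix (Fin n) (Fin n) ℝ), ν (∑ i, f i) ≤ ∑ i, ν (f i) := fun f =>
    Finset.le_sum_of_subadditive ν (map_zero ν).le (fun x y => map_add_le_add ν x y) _ _
  conv_lhs => rw [Matrix.matrix_eq_sum_single A]
  rw [Finset.mul_sum]
  refine (hsum _).trans (Finset.sum_le_sum fun i _ => (hsum _).trans ?_)
  rw [Finset.mul_sum]
  refine Finset.sum_le_sum fun j _ => ?_
  have h1 : Matrix.single i j (A i j) = A i j • Matrix.single i j (1 : ℝ) := by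
    rw [Matrix.smul_single, smul_eq_mul, mul_one]
  rw [h1, map_smul_eq_mul, Real.norm_eq_abs, mul_comm]
  exact mul_le_mul_of_nonneg_right ((hle i j).trans (by linarith)) (abs_nonneg _)

theorem exists_sum_abs_le_seminorm {n : ℕ} (ν : Seminorm ℝ (Matrix (Fin n) (Fin n) ℝ))
    (hν : ∀ A, ν A = 0 → A = 0) :
    ∃ c : ℝ, 0 < c ∧ ∀ A, c * ∑ i, ∑ j, |A i j| ≤ ν A := by
  obtain ⟨b, hb, hνb⟩ := exists_seminorm_le_sum_abs ν
  set σ : Matrix (Fin n) (Fin n) ℝ → ℝ := fun A => ∑ i, ∑ j, |A i j| with hσ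
  have hσc : Continuous σ := by
    refine continuous_finsetSum _ fun i _ => continuous_finsetSum _ fun j _ => ?_
    exact ((continuous_apply j).comp (continuous_apply i)).abs
  have hcont : Continuous ν := by
    rw [continuous_iff_continuousAt]
    intro A
    rw [ContinuousAt, tendsto_iff_dist_tendsto_zero]
    have h1 : Tendsto (fun B => b * σ (B - A)) (𝓝 A) (𝓝 0) := by
      have h2 : Continuous fun B => b * σ (B - A) :=
        continuous_const.mul (hσc.comp (continuous_id.sub continuous_const))
      have h3 := h2.tendsto A
      simpa [hσ] using h3
    refine squeeze_zero (fun _ => dist_nonneg) (fun B => ?_) h1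
    rw [Real.dist_eq]
    exact (abs_sub_map_le_sub ν B A).trans (hνb _)
  have hle : ∀ A i j, |A i j| ≤ σ A := fun A i j =>
    (Finset.single_le_sum (f := fun j => |A i j|) (fun k _ => abs_nonneg _)
      (Finset.mem_univ j)).trans
    (Finset.single_le_sum (f := fun i => ∑ j, |A i j|)
      (fun k _ => Finset.sum_nonneg fun j _ => abs_nonneg _) (Finset.mem_univ i))
  have hcomp : IsCompact {A | σ A = 1} := by
    have hbox : IsCompact (Set.pi univ fun _ : Fin n => Set.pi univ fun _ : Fin n =>
        Icc (-1 : ℝ) 1) :=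
      isCompact_univ_pi fun _ => isCompact_univ_pi fun _ => isCompact_Icc
    refine hbox.of_isClosed_subset (isClosed_eq hσc continuous_const) ?_
    intro A hA i _ j _
    have h1 := hle A i j
    rw [show σ A = 1 from hA] at h1
    exact abs_le.1 h1
  have hσ0 : ∀ A, 0 ≤ σ A := fun A =>
    Finset.sum_nonneg fun i _ => Finset.sum_nonneg fun j _ => abs_nonneg _
  have hσsmul : ∀ (t : ℝ) A, σ (t • A) = |t| * σ A := fun t A => by
    simp [hσ, abs_mul, Finset.mul_sum]
  have hnorm : ∀ A, σ A ≠ 0 → σ ((σ A)⁻¹ • A) = 1 := fun A hA => by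
    rw [hσsmul, abs_of_nonneg (inv_nonneg.2 (hσ0 A)), inv_mul_cancel₀ hA]
  rcases {A | σ A = 1}.eq_empty_or_nonempty with hemp | hne
  · refine ⟨1, one_pos, fun A => ?_⟩
    have : σ A = 0 := by
      by_contra h
      have h2 : (σ A)⁻¹ • A ∈ {A | σ A = 1} := hnorm A h
      rw [hemp] at h2
      exact h2
    show 1 * σ A ≤ ν A
    rw [this, mul_zero]
    exact apply_nonneg ν A
  · obtain ⟨A₀, hA₀, hmin⟩ := hcomp.exists_isMinOn hne hcont.continuousOn
    have hpos : 0 < ν A₀ := by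
      refine lt_of_le_of_ne (apply_nonneg ν A₀) fun h => ?_
      have h1 : σ A₀ = 1 := hA₀
      rw [hν A₀ h.symm] at h1
      simp [hσ] at h1
    refine ⟨ν A₀, hpos, fun A => ?_⟩
    show ν A₀ * σ A ≤ ν A
    by_cases h : σ A = 0
    · rw [h, mul_zero]; exact apply_nonneg ν A
    · have h1 : ν A₀ ≤ ν ((σ A)⁻¹ • A) := hmin (hnorm A h)
      rw [map_smul_eq_mul, Real.norm_of_nonneg (inv_nonneg.2 (hσ0 A)), inv_mul_eq_div,
        le_div_iff₀ (lt_of_le_of_ne (hσ0 A) (Ne.symm h))] at h1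
      exact h1

/-! ### Variants of the growth rate and the dimension bounds -/

theorem tendsto_log_ncard_lt_exp {ι : Type*} {L : ι → ℝ} (hfin : ∀ T, {w | L w ≤ T}.Finite)
    {x₀ : ℝ} (hx₀ : count L x₀ ≠ 0) {ρ : ℝ}
    (hlim : Tendsto (fun T : ℝ => Real.log (count L T) / Real.log T) atTop (𝓝 ρ)) :
    Tendsto (fun t : ℝ => 1 / t * Real.log ({w | L w < Real.exp t}.ncard : ℝ)) atTop (𝓝 ρ) := by
  have hup : Tendsto (fun t : ℝ => 1 / t * Real.log (count L (Real.exp t))) atTop (𝓝 ρ) := by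
    refine (hlim.comp Real.tendsto_exp_atTop).congr fun t => ?_
    simp only [Function.comp, Real.log_exp]
    ring
  have hhalf : Tendsto (fun t : ℝ => Real.exp t / 2) atTop atTop :=
    Real.tendsto_exp_atTop.atTop_div_const two_pos
  have hlow : Tendsto (fun t : ℝ => 1 / t * Real.log (count L (Real.exp t / 2))) atTop (𝓝 ρ) := by
    have h1 : Tendsto (fun t : ℝ => 1 - Real.log 2 * t⁻¹) atTop (𝓝 1) := by
      simpa using (tendsto_inv_atTop_zero.const_mul (Real.log 2)).const_sub 1
    have h2 := (hlim.comp hhalf).mul h1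
    rw [mul_one] at h2
    refine h2.congr' ?_
    filter_upwards [eventually_gt_atTop (Real.log 2), eventually_gt_atTop 0] with t ht ht0
    have h3 : Real.log (Real.exp t / 2) = t - Real.log 2 := by
      rw [Real.log_div (Real.exp_ne_zero t) two_ne_zero, Real.log_exp]
    simp only [Function.comp, h3]
    have h4 : t - Real.log 2 ≠ 0 := by linarith
    field_simp
  refine tendsto_of_tendsto_of_tendsto_of_le_of_le' hlow hup ?_ ?_
  all_goals
    filter_upwards [eventually_gt_atTop 0, hhalf.eventually_ge_atTop x₀] with t ht hx
    have hpos : 0 < count L (Real.exp t / 2) :=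
      (Nat.pos_of_ne_zero hx₀).trans_le (count_mono hfin hx)
    have hsub : {w | L w ≤ Real.exp t / 2} ⊆ {w | L w < Real.exp t} := fun w hw =>
      lt_of_le_of_lt hw (half_lt_self (Real.exp_pos t))
    have hsub' : {w | L w < Real.exp t} ⊆ {w | L w ≤ Real.exp t} := fun w (hw : L w < _) => hw.le
    have h1 : count L (Real.exp t / 2) ≤ {w | L w < Real.exp t}.ncard :=
      ncard_le_ncard hsub ((hfin _).subset hsub')
    have h2 : {w | L w < Real.exp t}.ncard ≤ count L (Real.exp t) :=
      ncard_le_ncard hsub' (hfin _)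
    refine mul_le_mul_of_nonneg_left (Real.log_le_log ?_ ?_) (by positivity)
  · exact_mod_cast hpos
  · exact_mod_cast h1
  · exact_mod_cast hpos.trans_le h1
  · exact_mod_cast h2

theorem eventually_rpow_le_count {ι : Type*} {L : ι → ℝ} (hfin : ∀ T, {w | L w ≤ T}.Finite)
    {x₀ : ℝ} (hx₀ : count L x₀ ≠ 0) {ρ s : ℝ} (hs : s < ρ)
    (hlim : Tendsto (fun T : ℝ => Real.log (count L T) / Real.log T) atTop (𝓝 ρ)) :
    ∀ᶠ T in atTop, T ^ s ≤ (count L T : ℝ) := by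
  filter_upwards [hlim.eventually_const_lt hs, eventually_gt_atTop 1, eventually_ge_atTop x₀]
    with T h1 h2 h3
  rw [lt_div_iff₀ (Real.log_pos h2)] at h1
  have hpos : 0 < count L T := (Nat.pos_of_ne_zero hx₀).trans_le (count_mono hfin h3)
  rw [← Real.log_le_log_iff (by positivity) (by exact_mod_cast hpos), Real.log_rpow (by linarith)]
  exact h1.le

/-- Membership of the exponent `0` is left open, so that the sets cut out by `0 ≤ r` and by `0 < r`
are handled together. -/
theorem isGLB_summable_rpow_neg {ι : Type*} {L : ι → ℝ} (hL : ∀ w, 0 < L w)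
    (hfin : ∀ T, {w | L w ≤ T}.Finite) {ρ : ℝ} (hρ : 0 ≤ ρ)
    (hlim : Tendsto (fun T : ℝ => Real.log (count L T) / Real.log T) atTop (𝓝 ρ)) {S : Set ℝ}
    (hS : ∀ r ∈ S, 0 ≤ r ∧ Summable fun w => L w ^ (-r))
    (hS' : ∀ r, 0 < r → (Summable fun w => L w ^ (-r)) → r ∈ S) : IsGLB S ρ := by
  refine ⟨fun r hr => le_of_summable_rpow_neg hL hfin (hS r hr).1 hlim (hS r hr).2, fun b hb => ?_⟩
  refine le_of_forall_gt_imp_ge_of_dense fun r hr => ?_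
  exact hb (hS' r (hρ.trans_lt hr) (summable_rpow_neg hL hfin hρ hr hlim))

theorem entrySum_eq_sum_abs {A : Matrix (Fin (d + 1)) (Fin (d + 1)) ℝ} (hA : IsAdmissible A) :
    ∑ i, ∑ j, |A i j| = entrySum A :=
  Finset.sum_congr rfl fun i _ => Finset.sum_congr rfl fun j _ => abs_of_nonneg (hA.1 i j)

theorem le_upperBoxDim_attractor_of_boundary (hN : ∀ j, IsAdmissible (N j)) (hd : 1 ≤ d)
    (hb : CoversBoundary N) : ((d - 1 : ℝ) : EReal) ≤ upperBoxDim (attractor N) := by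
  have hd0 : (0 : ℝ) < d := by exact_mod_cast hd
  refine le_upperBoxDim fun s' hs' => ⟨(1 / d) ^ (d - 1) / 2, by positivity, ?_⟩
  have h1 : ∀ᶠ ε : ℝ in 𝓝[>] 0, ε < 1 / d :=
    (eventually_lt_nhds (one_div_pos.2 hd0)).filter_mono nhdsWithin_le_nhds
  have h2 : ∀ᶠ ε : ℝ in 𝓝[>] 0, ε < 1 :=
    (eventually_lt_nhds one_pos).filter_mono nhdsWithin_le_nhds
  filter_upwards [h1, h2, self_mem_nhdsWithin] with ε h1 h2 h3
  have hε : 0 < ε := h3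
  refine le_trans (ENNReal.ofReal_le_ofReal ?_) (vol_nhd_attractor_ge_linear hN hd hb hε h1.le)
  refine mul_le_mul_of_nonneg_left ?_ (by positivity)
  calc ε ^ (d - s') ≤ ε ^ (1 : ℝ) :=
        Real.rpow_le_rpow_of_exponent_ge hε h2.le (by linarith)
    _ = ε := Real.rpow_one ε

theorem le_upperBoxDim_attractor_of_count (hN : ∀ j, IsAdmissible (N j)) (hd : 1 ≤ d)
    (hb : CoversBoundary N)
    (hdis : Pairwise fun j k => Disjoint ((N j).mulVec '' openOrthant (d + 1))
      ((N k).mulVec '' openOrthant (d + 1))) (hne : (holeCone N).Nonempty) {ρ a : ℝ} (ha : 0 < a)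
    {f : ℝ → ℕ} (hf : ∀ T, f (a * T) ≤ count (fun w => entrySum (wordMat N w)) T)
    (hev : ∀ s < ρ, ∀ᶠ T in atTop, T ^ s ≤ (f T : ℝ)) :
    ((d * ρ / (d + 1) : ℝ) : EReal) ≤ upperBoxDim (attractor N) := by
  have hd0 : (0 : ℝ) < d := by exact_mod_cast hd
  obtain ⟨c, hc, hvol⟩ := vol_nhd_attractor_ge hN hd hb hdis hne
  refine le_upperBoxDim fun s' hs' => ?_
  -- Chosen so that `T ^ s = ε ^ (-s')` when `T = ε ^ (-d / (d + 1))`.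
  set s := s' * (d + 1) / d with hs
  have hsρ : s < ρ := by
    rw [lt_div_iff₀ (by positivity)] at hs'
    rw [hs, div_lt_iff₀ hd0]
    linarith
  refine ⟨c * a ^ s, by positivity, ?_⟩
  have hT : Tendsto (fun ε : ℝ => a * ε ^ (-((d : ℝ) / (d + 1)))) (𝓝[>] 0) atTop :=
    (tendsto_rpow_neg_nhdsGT_zero (neg_neg_of_pos (by positivity))).const_mul_atTop ha
  filter_upwards [hT.eventually (hev s hsρ), self_mem_nhdsWithin] with ε h1 h2
  have hε : 0 < ε := h2
  set T := ε ^ (-((d : ℝ) / (d + 1))) with hTdef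
  have hT0 : 0 < T := by positivity
  refine le_trans (ENNReal.ofReal_le_ofReal ?_) (hvol ε T hε hT0 ?_)
  · have h3 : a ^ s * ε ^ (-s') ≤ count (fun w => entrySum (wordMat N w)) T := by
      refine le_trans (le_of_eq ?_) (h1.trans (by exact_mod_cast hf T))
      rw [Real.mul_rpow ha.le hT0.le, hTdef, ← Real.rpow_mul hε.le]
      congr 2
      rw [hs]
      field_simp
    calc c * a ^ s * ε ^ (d - s') = c * ε ^ d * (a ^ s * ε ^ (-s')) := by
          rw [sub_eq_add_neg, Real.rpow_add hε, Real.rpow_natCast]; ring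
      _ ≤ _ := mul_le_mul_of_nonneg_left h3 (by positivity)
  · rw [hTdef, ← Real.rpow_neg hε.le, neg_neg, ← Real.rpow_natCast, ← Real.rpow_mul hε.le,
      ← Real.rpow_natCast]
    congr 1
    push_cast
    field_simp

end SelfProjective

/-! ### The main theorem -/

theorem theorem3 (d m : ℕ) (hd : 2 ≤ d)
    (N : Fin m → Matrix (Fin (d + 1)) (Fin (d + 1)) ℝ)
    (hN : ∀ j, SelfProjective.IsAdmissible (N j))
    (hdisj : Pairwise fun j k =>
      Disjoint
        (SelfProjective.relInterior (SelfProjective.proj (N j) '' SelfProjective.simplex d))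
        (SelfProjective.relInterior (SelfProjective.proj (N k) '' SelfProjective.simplex d)))
    (hvol : SelfProjective.vol d (SelfProjective.attractor N) = 0)
    (hholes : ∀ H, SelfProjective.IsMainHole N H → SelfProjective.IsInteriorOfSimplex H)
    (ν : Seminorm ℝ (Matrix (Fin (d + 1)) (Fin (d + 1)) ℝ))
    (hν : ∀ A, ν A = 0 → A = 0) :
    ∃ ρ : ℝ,
      -- `ρ` is the critical exponent, over all words and over all non-empty words
      IsGLB {r : ℝ | 0 ≤ r ∧ Summable fun w : List (Fin m) =>
        ν (SelfProjective.wordMat N w) ^ (-r)} ρ ∧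
      IsGLB {r : ℝ | 0 < r ∧ Summable fun w : {w : List (Fin m) // w ≠ []} =>
        ν (SelfProjective.wordMat N w.1) ^ (-r)} ρ ∧
      -- `ρ` is the growth rate of the numbers of words, which are finite
      (∀ T : ℝ, {w : List (Fin m) | ν (SelfProjective.wordMat N w) ≤ T}.Finite) ∧
      Tendsto (fun T : ℝ =>
        Real.log ({w : List (Fin m) | ν (SelfProjective.wordMat N w) ≤ T}.ncard : ℝ) / Real.log T)
        atTop (𝓝 ρ) ∧
      Tendsto (fun t : ℝ => 1 / t *
        Real.log ({w : List (Fin m) | ν (SelfProjective.wordMat N w) < Real.exp t}.ncard : ℝ))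
        atTop (𝓝 ρ) ∧
      -- the lower bounds for the upper box-counting dimension
      (((d - 1) / d * ρ : ℝ) : EReal) ≤
        SelfProjective.upperBoxDim (SelfProjective.attractor N) ∧
      ((max (d - 1) (d * ρ / (d + 1)) : ℝ) : EReal) ≤
        SelfProjective.upperBoxDim (SelfProjective.attractor N) := by
  have hd1 : 1 ≤ d := by omega
  have hb := SelfProjective.coversBoundary_of_isInteriorOfSimplex hN hd1 hholes
  have hdis := SelfProjective.disjoint_image_openOrthant hN hdisj
  have hne := SelfProjective.holeCone_nonempty hN hb hvol
  have := SelfProjective.nontrivial_of_coversBoundary hd1 hb hne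
  have hadm := SelfProjective.isAdmissible_wordMat hN
  obtain ⟨b, hb0, hνb⟩ := SelfProjective.exists_seminorm_le_sum_abs ν
  obtain ⟨a, ha0, hνa⟩ := SelfProjective.exists_sum_abs_le_seminorm ν hν
  set e : List (Fin m) → ℝ := fun w => SelfProjective.entrySum (SelfProjective.wordMat N w) with he
  have he0 : ∀ w, 0 < e w := fun w => (hadm w).entrySum_pos
  set L : List (Fin m) → ℝ := fun w => ν (SelfProjective.wordMat N w) with hLdef
  have hLa : ∀ w, a * e w ≤ L w := fun w => by
    have := hνa (SelfProjective.wordMat N w)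
    rwa [SelfProjective.entrySum_eq_sum_abs (hadm w)] at this
  have hLb : ∀ w, L w ≤ b * e w := fun w => by
    have := hνb (SelfProjective.wordMat N w)
    rwa [SelfProjective.entrySum_eq_sum_abs (hadm w)] at this
  have hL : ∀ w, 0 < L w := fun w => (mul_pos ha0 (he0 w)).trans_le (hLa w)
  have hea : ∀ w, e w ≤ L w / a := fun w => by
    rw [le_div_iff₀ ha0]; linarith [hLa w]
  have hefin : ∀ T, {w | e w ≤ T}.Finite := SelfProjective.finite_entrySum_le hN hdis hne
  have hsub : ∀ T, {w | L w ≤ a * T} ⊆ {w | e w ≤ T} := fun T w hw =>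
    le_of_mul_le_mul_left ((hLa w).trans hw) ha0
  have hfin : ∀ T, {w | L w ≤ T}.Finite := fun T => by
    refine (hefin (T / a)).subset ?_
    have := hsub (T / a)
    rwa [mul_div_cancel₀ _ ha0.ne'] at this
  have hmul : ∀ u v, L (u ++ v) ≤ b / a ^ 2 * L u * L v := fun u v => by
    have h1 : e (u ++ v) ≤ e u * e v := by
      simp only [he]
      rw [SelfProjective.wordMat_append]
      exact SelfProjective.entrySum_mul_le (hadm u) (hadm v)
    calc L (u ++ v) ≤ b * (e u * e v) :=
          (hLb _).trans (mul_le_mul_of_nonneg_left h1 hb0.le)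
      _ ≤ b * (L u / a * (L v / a)) := mul_le_mul_of_nonneg_left
          (mul_le_mul (hea u) (hea v) (he0 v).le (div_nonneg (hL u).le ha0.le)) hb0.le
      _ = b / a ^ 2 * L u * L v := by field_simp
  -- Bounds the cost of appending one letter, uniformly in the letter.
  set K := b / a ^ 2 * ∑ j, L [j] with hKdef
  have hsum0 : 0 < ∑ j, L [j] := by
    obtain ⟨j, -, -⟩ := exists_pair_ne (Fin m)
    exact Finset.sum_pos (fun j _ => hL _) ⟨j, Finset.mem_univ j⟩
  have hK0 : 0 < K := by positivity
  have hK : ∀ w j, L (w ++ [j]) ≤ K * L w := fun w j => by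
    have h1 : L [j] ≤ ∑ j, L [j] :=
      Finset.single_le_sum (f := fun j => L [j]) (fun k _ => (hL _).le) (Finset.mem_univ j)
    have h2 : 0 ≤ b / a ^ 2 * L w := mul_nonneg (by positivity) (hL w).le
    calc L (w ++ [j]) ≤ b / a ^ 2 * L w * L [j] := hmul _ _
      _ ≤ b / a ^ 2 * L w * ∑ j, L [j] := mul_le_mul_of_nonneg_left h1 h2
      _ = K * L w := by rw [hKdef]; ring
  have hx₀ : SelfProjective.count L (L []) ≠ 0 :=
    ((ncard_pos (hfin _)).2 ⟨[], le_refl (L [])⟩).ne'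
  obtain ⟨A, hA⟩ := SelfProjective.exists_card_le_entrySum hN hdis hne
  obtain ⟨ρ, hρ, hlim⟩ := SelfProjective.exists_tendsto_log_div_log
    (SelfProjective.count_mono hfin) (κ := b / a ^ 2 * K) (by positivity)
    (SelfProjective.count_mul_count_le hfin (fun w => (hL w).le) (by positivity) hK0.le hK hmul)
    hx₀ (A := A * a⁻¹ ^ (d + 1)) (D := d + 1) (fun x hx => by
      rw [SelfProjective.count, ncard_eq_toFinset_card _ (hfin x), mul_assoc, ← mul_pow]
      refine hA _ _ (by positivity) fun w hw => ?_
      have hw' : L w ≤ x := by simpa using hw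
      rw [inv_mul_eq_div]
      exact (hea w).trans (div_le_div_of_nonneg_right hw' ha0.le))
  have hdim : ((d * ρ / (d + 1) : ℝ) : EReal) ≤
      SelfProjective.upperBoxDim (SelfProjective.attractor N) :=
    SelfProjective.le_upperBoxDim_attractor_of_count hN hd1 hb hdis hne ha0
      (f := SelfProjective.count L) (fun T => ncard_le_ncard (hsub T) (hefin T))
      fun s hs => SelfProjective.eventually_rpow_le_count hfin hx₀ hs hlim
  have hd0 : (0 : ℝ) < d := by exact_mod_cast hd1
  refine ⟨ρ, ?_, ?_, hfin, hlim, SelfProjective.tendsto_log_ncard_lt_exp hfin hx₀ hlim, ?_, ?_⟩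
  · exact SelfProjective.isGLB_summable_rpow_neg hL hfin hρ hlim (fun r hr => hr)
      fun r hr hs => ⟨hr.le, hs⟩
  · have hiff : ∀ r : ℝ, (Summable fun w : {w : List (Fin m) // w ≠ []} => L w.1 ^ (-r)) ↔
        Summable fun w => L w ^ (-r) := fun r =>
      (Set.finite_singleton ([] : List (Fin m))).summable_compl_iff (f := fun w => L w ^ (-r))
    exact SelfProjective.isGLB_summable_rpow_neg hL hfin hρ hlim
      (fun r hr => ⟨hr.1.le, (hiff r).1 hr.2⟩) fun r hr hs => ⟨hr, (hiff r).2 hs⟩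
  · refine le_trans ?_ hdim
    rw [EReal.coe_le_coe_iff, div_mul_eq_mul_div, div_le_div_iff₀ hd0 (by positivity)]
    -- Uses `ρ ≥ 0` and `(d - 1) * (d + 1) ≤ d ^ 2`.
    nlinarith
  · rcases max_choice ((d : ℝ) - 1) (d * ρ / (d + 1)) with h | h <;> rw [h]
    · exact SelfProjective.le_upperBoxDim_attractor_of_boundary hN hd1 hb
    · exact hdim
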